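/- Let $R$ be a UFD of characteristic $p>0$, let $R[x,y]$ and $R[y_0,y_1,y_2]$ be polynomial rings over $R$, let $0\neq a\in R$, and let $0\ne\theta(y)=\sum_{i\ge1}s_iy^i\in yR[y]$. Put $f:=ax+\theta(y)$ and let $0\neq F\in R[f]$. Let $\phi$ be the Nagata type automorphism, i.e. the $R$-automorphism of $R[x,y]$ given by $\phi(x)=x+a^{-1}(\theta(y)-\theta(y+aF))$ and $\phi(y)=y+aF$, and let $R[x,y]^\phi=\{g\in R[x,y]\mid\phi(g)=g\}$. Define $q:=y^p-(aF)^{p-1}y$, $\theta^*(y):=\sum_{i\ge1}s_{pi}y^i$, and let $d\in R$ be a greatest common divisor of $a$ and $\theta'(y)$ in $R[x,y]$ (one exists; any choice is allowed). Put $$b:=ad^{-1},\quad \rho(y):=\sum_{p\nmid i}t_iy^i\ \text{ with } t_i:=s_id^{-1},\quad \rho^p(y):=\sum_{p\nmid i}t_i^py^i,$$ $$q_1:=d^{-1}(f-\theta^*(q)),\qquad \widetilde q_1:=b^{1-p}(q_1^p-\rho^p(q)).$$ Then $b\in R$, $\rho\in R[y]$ and $q_1,\widetilde q_1\in R[x,y]$;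 there exists a polynomial $\lambda$ in two variables over $R$ with $\rho'(y)^p\,y=\lambda(y^p,\rho(y))$; and there exists a polynomial $\nu$ in two variables over $R$ with $(dF)^{p-1}=\nu(q,q_1)$. For every such choice of $\lambda$ and $\nu$, the element $$q_2:=b^{-1}\bigl(\widetilde q_1-\lambda(q,q_1)(dF)^{p-1}\bigr)$$ lies in $R[x,y]$, the elements $q,q_1,q_2$ are $\phi$-invariant, and: 1. $R[x,y]^\phi=R[q,q_1,q_2]$. 2. The kernel of the substitution map $\sigma:R[y_0,y_1,y_2]\to R[x,y]^\phi$, $h(y_0,y_1,y_2)\mapsto h(q,q_1,q_2)$, is the principal ideal generated by $$\Lambda:=b^py_2+\rho^p(y_0)-y_1^p+b^{p-1}\lambda(y_0,y_1)\nu(y_0,y_1).$$ 3. Hence $R[x,y]^\phi\cong R[y_0,y_1,y_2]/(\Lambda)$ as $R$-algebras. -/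

import Mathlib

open Polynomial

noncomputable section

namespace Nagata

variable {R : Type*} [CommRing R]

/-- The polynomial ring `R[x, y]` in two variables. -/
abbrev Poly2 (R : Type*) [CommRing R] : Type _ := MvPolynomial (Fin 2) R

/-- The polynomial ring `R[y₀, y₁, y₂]` in three variables. -/
abbrev Poly3 (R : Type*) [CommRing R] : Type _ := MvPolynomial (Fin 3) R

/-- The variable `x` of `R[x, y]`. -/
def x (R : Type*) [CommRing R] : Poly2 R := MvPolynomial.X 0

/-- The variable `y` of `R[x, y]`. -/
def y (R : Type*) [CommRing R] : Poly2 R := MvPolynomial.X 1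

/-- `f = a x + θ(y)`. -/
def f (a : R) (θ : R[X]) : Poly2 R := MvPolynomial.C a * x R + aeval (y R) θ

/-- `a⁻¹ (θ(y + a F) - θ(y))`, an element of `R[x, y]`, written out through the Taylor expansion
`θ(y + U) = ∑ θᵢ(y) Uⁱ`, in which `θᵢ` is the `i`-th Hasse derivative of `θ`
(see `C_mul_quot`). -/
def quot (a : R) (θ : R[X]) (F : Poly2 R) : Poly2 R :=
  ∑ i ∈ Finset.range θ.natDegree,
    aeval (y R) (hasseDeriv (i + 1) θ) * MvPolynomial.C a ^ i * F ^ (i + 1)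

/-- The `R`-algebra endomorphism `x ↦ x + a⁻¹ (θ(y) - θ(y + a F))`, `y ↦ y + a F`. -/
def hom (a : R) (θ : R[X]) (F : Poly2 R) : Poly2 R →ₐ[R] Poly2 R :=
  MvPolynomial.aeval ![x R - quot a θ F, y R + MvPolynomial.C a * F]

theorem map_hasseDeriv {S : Type*} [CommRing S] (g : R →+* S) (k : ℕ) (P : R[X]) :
    hasseDeriv k (P.map g) = (hasseDeriv k P).map g := by
  ext n
  simp [hasseDeriv_coeff]

theorem C_mul_quot (a : R) (θ : R[X]) (F : Poly2 R) :
    MvPolynomial.C a * quot a θ F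
      = aeval (y R + MvPolynomial.C a * F) θ - aeval (y R) θ := by
  have h : aeval (y R + MvPolynomial.C a * F) θ
      = ∑ i ∈ Finset.range (θ.natDegree + 1),
          aeval (y R) (hasseDeriv i θ) * (MvPolynomial.C a * F) ^ i := by
    have h1 : aeval (y R + MvPolynomial.C a * F) θ
        = (taylor (y R) (θ.map (algebraMap R (Poly2 R)))).eval (MvPolynomial.C a * F) := by
      rw [taylor_eval, eval_map_algebraMap, add_comm]
    rw [h1, eval_eq_sum_range' (n := θ.natDegree + 1)]
    · refine Finset.sum_congr rfl fun i _ => ?_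
      rw [taylor_coeff, map_hasseDeriv, eval_map_algebraMap]
    · rw [natDegree_taylor]
      exact Nat.lt_succ_of_le natDegree_map_le
  rw [h, Finset.sum_range_succ', quot, Finset.mul_sum]
  simp only [hasseDeriv_zero, LinearMap.id_coe, id_eq, pow_zero, mul_one, add_sub_cancel_right]
  refine Finset.sum_congr rfl fun i _ => ?_
  ring

theorem hom_x (a : R) (θ : R[X]) (F : Poly2 R) : hom a θ F (x R) = x R - quot a θ F := by
  simp [hom, x]

theorem hom_y (a : R) (θ : R[X]) (F : Poly2 R) :
    hom a θ F (y R) = y R + MvPolynomial.C a * F := by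
  simp [hom, y]

theorem hom_f (a : R) (θ : R[X]) (F : Poly2 R) : hom a θ F (f a θ) = f a θ := by
  have hC : hom a θ F (MvPolynomial.C a) = MvPolynomial.C a := (hom a θ F).commutes a
  rw [f, map_add, map_mul, hC, hom_x, ← aeval_algHom_apply, hom_y, mul_sub, C_mul_quot]
  ring

theorem hom_of_mem (a : R) (θ : R[X]) (F : Poly2 R) {G : Poly2 R}
    (hG : G ∈ Algebra.adjoin R {f a θ}) : hom a θ F G = G := by
  have h : Algebra.adjoin R {f a θ}
      ≤ AlgHom.equalizer (hom a θ F) (AlgHom.id R (Poly2 R)) := by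
    rw [Algebra.adjoin_le_iff, Set.singleton_subset_iff]
    exact hom_f a θ F
  exact h hG

theorem hom_comp_neg [IsDomain R] {a : R} (ha : a ≠ 0) (θ : R[X]) {F : Poly2 R}
    (hF : F ∈ Algebra.adjoin R {f a θ}) :
    (hom a θ (-F)).comp (hom a θ F) = AlgHom.id R (Poly2 R) := by
  have hy : hom a θ (-F) (hom a θ F (y R)) = y R := by
    have hC : hom a θ (-F) (MvPolynomial.C a) = MvPolynomial.C a := (hom a θ (-F)).commutes a
    rw [hom_y, map_add, map_mul, hC, hom_y, hom_of_mem a θ (-F) hF]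
    ring
  have hx : hom a θ (-F) (hom a θ F (x R)) = x R := by
    have hCa : (MvPolynomial.C a : Poly2 R) ≠ 0 := by simpa using ha
    have hC : ((hom a θ (-F)).comp (hom a θ F)) (MvPolynomial.C a) = MvPolynomial.C a :=
      ((hom a θ (-F)).comp (hom a θ F)).commutes a
    have hf : ((hom a θ (-F)).comp (hom a θ F)) (f a θ) = f a θ := by
      rw [AlgHom.comp_apply, hom_f, hom_f]
    rw [f, map_add, map_mul, hC, ← aeval_algHom_apply, AlgHom.comp_apply, AlgHom.comp_apply,
      hy] at hf
    exact mul_left_cancel₀ hCa (add_right_cancel hf)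
  refine MvPolynomial.algHom_ext fun i => ?_
  fin_cases i
  · exact hx
  · exact hy

/-- The Nagata type automorphism `φ` of `R[x, y]` over `R`:
`φ(x) = x + a⁻¹ (θ(y) - θ(y + a F))` and `φ(y) = y + a F`, where `F ∈ R[f]`. -/
def aut [IsDomain R] (a : R) (ha : a ≠ 0) (θ : R[X]) (F : Poly2 R)
    (hF : F ∈ Algebra.adjoin R {f a θ}) : Poly2 R ≃ₐ[R] Poly2 R :=
  AlgEquiv.ofAlgHom (hom a θ F) (hom a θ (-F))
    (by simpa using hom_comp_neg ha θ (F := -F) (neg_mem hF)) (hom_comp_neg ha θ hF)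

/-- The invariant ring `R[x, y]^φ = {g | φ(g) = g}`. -/
def invariants (φ : Poly2 R ≃ₐ[R] Poly2 R) : Subalgebra R (Poly2 R) :=
  AlgHom.equalizer (φ : Poly2 R →ₐ[R] Poly2 R) (AlgHom.id R (Poly2 R))

/-- `q = y^p - (a F)^(p-1) y`. -/
def q (p : ℕ) (a : R) (F : Poly2 R) : Poly2 R :=
  y R ^ p - (MvPolynomial.C a * F) ^ (p - 1) * y R

/-- `d` is a greatest common divisor of `a` and `θ'(y)` in `R[x, y]`
(it is unique up to a unit of `R`). -/
def IsGcd (a : R) (θ : R[X]) (d : R) : Prop :=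
  ∀ e : Poly2 R, e ∣ MvPolynomial.C d ↔
    e ∣ MvPolynomial.C a ∧ e ∣ aeval (y R) (derivative θ)

/-- `ρ = ∑_{p ∤ i} tᵢ Tⁱ` with `tᵢ = sᵢ / d`, where `θ = ∑ sᵢ Tⁱ`. -/
def IsRho (p : ℕ) (θ : R[X]) (d : R) (ρ : R[X]) : Prop :=
  (∀ i, ¬ p ∣ i → d * ρ.coeff i = θ.coeff i) ∧ ∀ i, p ∣ i → ρ.coeff i = 0

/-- `θ* = ∑_{i ≥ 1} s_{p i} Tⁱ`, where `θ = ∑ sᵢ Tⁱ`. -/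
def thetaStar (p : ℕ) (θ : R[X]) : R[X] :=
  ∑ i ∈ Finset.Icc 1 θ.natDegree, C (θ.coeff (p * i)) * X ^ i

/-- `ρ^p = ∑ tᵢ^p Tⁱ` for `ρ = ∑ tᵢ Tⁱ`: the coefficients (only) are raised to the power `p`. -/
def coeffPow (p : ℕ) (ρ : R[X]) : R[X] :=
  ∑ i ∈ Finset.range (ρ.natDegree + 1), C (ρ.coeff i ^ p) * X ^ i

/-- `Λ = b^p y₂ + ρ^p(y₀) - y₁^p + b^(p-1) λ(y₀, y₁) ν(y₀, y₁)`. -/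
def Lambda (p : ℕ) (b : R) (ρ : R[X]) (lam nu : MvPolynomial (Fin 2) R) : Poly3 R :=
  MvPolynomial.C (b ^ p) * MvPolynomial.X 2 + aeval (MvPolynomial.X 0) (coeffPow p ρ)
    - MvPolynomial.X 1 ^ p
    + MvPolynomial.C (b ^ (p - 1))
      * MvPolynomial.aeval ![MvPolynomial.X 0, MvPolynomial.X 1] lam
      * MvPolynomial.aeval ![MvPolynomial.X 0, MvPolynomial.X 1] nu

end Nagata

end

/-!
Over the fraction field of `R` the invariants are polynomials in `f` and `q`: since `φ` fixes `f`
and `F` and maps `y` to `y + aF`, an invariant is a polynomial in `y` over `R[f]` (after inverting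
`a`) that is invariant under a translation, hence a polynomial in the additive polynomial `q`. As
`f = θ*(q) + d q₁`, some power of `a` multiplies every invariant into `R[q, q₁, q₂]`, and it
remains to show that `R[q, q₁, q₂]` is saturated at each prime `ϖ ∣ a`.

Modulo `ϖ` the element `q` becomes `y ^ p`. If `ϖ ∤ b`, then `q₁` still has degree one in
`x`, so `q` and `q₁` stay algebraically independent. If `ϖ ∣ b`, then `q₁` becomes `ρ(y)`, while
`q₂` becomes monic of degree `p` in `x`; since `d` is the greatest common divisor, `ρ' ≠ 0` modulo
`ϖ`, and the relations between `y ^ p` and `ρ(y)` are generated by `ρ(y) ^ p = ρ^p(y ^ p)`. In both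
cases all relations between the reductions of `q`, `q₁`, `q₂` are multiples of the reduction of
`Λ`, so a relation modulo `ϖ` lifts to one over `R`, and an element of `R[q, q₁, q₂]` that is
divisible by `ϖ` is `ϖ` times an element of `R[q, q₁, q₂]`.
-/

namespace Nagata

section Taylor

variable {R T : Type*} [CommRing R] [CommRing T] [Algebra R T]

theorem exists_mem_aeval_add_eq (A : Subalgebra R T) (P : R[X]) {s u : T} (hs : s ∈ A)
    (hu : u ∈ A) :
    ∃ k ∈ A, aeval (s + u) P = aeval s P + aeval s (derivative P) * u + k * u ^ 2 := by
  obtain ⟨k, hk⟩ := binomExpansion (P.map (algebraMap R A)) ⟨s, hs⟩ ⟨u, hu⟩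
  refine ⟨k, k.2, ?_⟩
  simp only [derivative_map, eval_map_algebraMap] at hk
  simpa only [map_add, map_mul, map_pow, ← aeval_algHom_apply] using! congrArg A.val hk

theorem exists_mvAeval_add_mul_eq {σ : Type*} [Fintype σ] (s u : σ → T) (b : T)
    (P : MvPolynomial σ R) :
    ∃ m : T, MvPolynomial.aeval (fun i => s i + b * u i) P
      = MvPolynomial.aeval s P
        + b * ∑ i, u i * MvPolynomial.aeval s (MvPolynomial.pderiv i P) + b ^ 2 * m := by
  classical
  induction P using MvPolynomial.induction_on with
  | C c => exact ⟨0, by simp⟩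
  | add P Q hP hQ =>
    obtain ⟨m, hm⟩ := hP
    obtain ⟨n, hn⟩ := hQ
    refine ⟨m + n, ?_⟩
    simp only [map_add, hm, hn, mul_add, Finset.sum_add_distrib]
    ring
  | mul_X P j hP =>
    obtain ⟨m, hm⟩ := hP
    set L := ∑ i, u i * MvPolynomial.aeval s (MvPolynomial.pderiv i P) with hL
    have hsum : ∑ i, u i * MvPolynomial.aeval s (MvPolynomial.pderiv i (P * MvPolynomial.X j))
        = u j * MvPolynomial.aeval s P + s j * L := by
      simp only [Derivation.leibniz, MvPolynomial.pderiv_X, Pi.single_apply, smul_eq_mul, map_add,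
        map_mul, apply_ite (MvPolynomial.aeval s), map_zero, MvPolynomial.aeval_X, mul_add,
        Finset.sum_add_distrib, mul_ite, mul_one, mul_zero, Finset.sum_ite_eq,
        Finset.mem_univ, if_true, hL, Finset.mul_sum, mul_left_comm (s j)]
    refine ⟨m * (s j + b * u j) + L * u j, ?_⟩
    rw [hsum, map_mul, map_mul, MvPolynomial.aeval_X, MvPolynomial.aeval_X, hm]
    ring

theorem exists_mul_eq_map_C_sub_C (ρ : R[X]) :
    ∃ K : R[X][X], ρ.map C - C ρ = (X - C X) * K ∧ K.eval X = derivative ρ := by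
  have hroot : (ρ.map C - C ρ).IsRoot X := by
    simp [eval_map, eval₂_C_X]
  obtain ⟨K, hK⟩ := dvd_iff_isRoot.2 hroot
  refine ⟨K, hK, ?_⟩
  have h := congrArg (fun P => eval X (derivative P)) hK
  simpa [derivative_map, eval_map, eval₂_C_X] using h.symm

end Taylor

section PrimeCharacteristic

variable {R : Type*} [CommRing R] (p : ℕ) [Fact p.Prime] [CharP R p]

theorem natCast_factorial_pred_eq_neg_one : (((p - 1).factorial : ℕ) : R) = -1 := by
  rw [← map_natCast (ZMod.castHom (dvd_refl p) R), ZMod.wilsons_lemma, map_neg, map_one]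

theorem iterate_derivative_char (P : R[X]) : derivative^[p] P = 0 := by
  rw [← factorial_smul_hasseDeriv, LinearMap.smul_apply, ← Nat.cast_smul_eq_nsmul R,
    (CharP.cast_eq_zero_iff R p _).2 (Nat.dvd_factorial (NeZero.pos p) le_rfl), zero_smul]

variable [NoZeroDivisors R]

theorem iterate_derivative_pred_mem_adjoin_X_pow (P : R[X]) :
    derivative^[p - 1] P ∈ Algebra.adjoin R {(X ^ p : R[X])} := by
  have hzero : derivative (derivative^[p - 1] P) = 0 := by
    rw [← Function.iterate_succ_apply' derivative, Nat.succ_eq_add_one,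
      Nat.sub_add_cancel (NeZero.one_le), iterate_derivative_char]
  rw [← expand_contract p hzero (NeZero.ne p), expand_eq_comp_X_pow, comp_eq_aeval]
  exact aeval_mem_adjoin_singleton R _

/- Differentiating `(ρ(T) - ρ(X)) ^ (p - 1) * g(T)` `p - 1` times in `T` and putting `T = X` only
leaves `(p - 1)! * ρ' ^ (p - 1) * g`. -/
theorem derivative_pow_pred_mul_mem_adjoin (ρ g : R[X]) :
    derivative ρ ^ (p - 1) * g ∈ Algebra.adjoin R {(X ^ p : R[X]), ρ} := by
  obtain ⟨K, hK, hK'⟩ := exists_mul_eq_map_C_sub_C ρ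
  have heval (P : R[X]) : eval X (P.map C) = P := by rw [eval_map, eval₂_C_X]
  have hlead : eval X (derivative^[p - 1] ((ρ.map C - C ρ) ^ (p - 1) * g.map C))
      = -(derivative ρ ^ (p - 1) * g) := by
    rw [hK, mul_pow, mul_assoc, ← coe_aeval_eq_eval,
      aeval_iterate_derivative_self _ _ _ (map_id ..), ← Nat.cast_smul_eq_nsmul R[X],
      natCast_factorial_pred_eq_neg_one, eval_mul, eval_pow, hK', heval, neg_one_smul]
  rw [← neg_mem_iff, ← hlead, sub_pow, Finset.sum_mul, iterate_derivative_sum, eval_finsetSum]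
  refine sum_mem fun m _ => ?_
  have hterm : (-1) ^ (m + (p - 1)) * ρ.map C ^ m * C ρ ^ (p - 1 - m) * ((p - 1).choose m : ℕ)
        * g.map C
      = C ((-1) ^ (m + (p - 1)) * ρ ^ (p - 1 - m) * ((p - 1).choose m : ℕ))
        * (ρ ^ m * g).map C := by
    simp only [C_mul, C_pow, C_neg, C_1, Polynomial.map_mul, Polynomial.map_pow, map_natCast]
    ring
  rw [hterm, iterate_derivative_C_mul, iterate_derivative_map, eval_mul, eval_C, heval]
  have hρ : ρ ∈ Algebra.adjoin R {(X ^ p : R[X]), ρ} := Algebra.subset_adjoin (by simp)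
  have hcoeff := iterate_derivative_pred_mem_adjoin_X_pow p (ρ ^ m * g)
  exact mul_mem (mul_mem (mul_mem (pow_mem (neg_mem (one_mem _)) _) (pow_mem hρ _))
    (natCast_mem _ _)) (Algebra.adjoin_mono (by simp) hcoeff)

end PrimeCharacteristic

section Adjoin

variable {R T : Type*} [CommRing R] [CommRing T] [Algebra R T]

theorem adjoin_pair_eq_range (u v : T) :
    Algebra.adjoin R {u, v} = (MvPolynomial.aeval ![u, v] : Poly2 R →ₐ[R] T).range := by
  rw [← Algebra.adjoin_range_eq_range_aeval, Matrix.range_cons_cons_empty]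

theorem adjoin_triple_eq_range (u v w : T) :
    Algebra.adjoin R {u, v, w}
      = (MvPolynomial.aeval ![u, v, w] : Poly3 R →ₐ[R] T).range := by
  rw [← Algebra.adjoin_range_eq_range_aeval, Matrix.range_cons, Matrix.range_cons_cons_empty,
    Set.singleton_union]

end Adjoin

theorem exists_derivative_pow_mul_X_eq_aeval {R : Type*} [CommRing R] [NoZeroDivisors R] (p : ℕ)
    [Fact p.Prime] [CharP R p] (ρ : R[X]) :
    ∃ lam : MvPolynomial (Fin 2) R,
      derivative ρ ^ p * X = MvPolynomial.aeval ![X ^ p, ρ] lam := by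
  have hmem := derivative_pow_pred_mul_mem_adjoin p ρ (derivative ρ * X)
  rw [← mul_assoc, pow_sub_one_mul (NeZero.ne p), adjoin_pair_eq_range] at hmem
  obtain ⟨lam, hlam⟩ := hmem
  exact ⟨lam, hlam.symm⟩

section Translation

variable {S : Type*} [CommRing S]

theorem taylor_modByMonic_divByMonic {Q : S[X]} (hQ : Q.Monic) {c : S} (hQc : taylor c Q = Q)
    {G : S[X]} (hG : taylor c G = G) :
    taylor c (G %ₘ Q) = G %ₘ Q ∧ taylor c (G /ₘ Q) = G /ₘ Q := by
  nontriviality S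
  have hdecomp : taylor c (G %ₘ Q) + Q * taylor c (G /ₘ Q) = G := by
    conv_rhs => rw [← hG, ← modByMonic_add_div G Q, map_add, taylor_mul, hQc]
  have hdeg : (taylor c (G %ₘ Q)).degree < Q.degree := by
    rw [degree_taylor]; exact degree_modByMonic_lt G hQ
  obtain ⟨hdiv, hmod⟩ := div_modByMonic_unique _ _ hQ ⟨hdecomp, hdeg⟩
  exact ⟨hmod.symm, hdiv.symm⟩

theorem eq_C_eval_zero_of_taylor_eq [IsDomain S] {p : ℕ} [CharP S p] {c : S}
    (hc : c ≠ 0) {G : S[X]} (hG : taylor c G = G) (hdeg : G.natDegree < p) : G = C (G.eval 0) := by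
  have heval (k : ℕ) : G.eval (k * c) = G.eval 0 := by
    induction k with
    | zero => simp
    | succ k ih => rw [Nat.cast_succ, add_one_mul, ← taylor_eval, hG, ih]
  have hinj : Function.Injective fun i : Fin p => (i : ℕ) * c := fun i j hij => by
    have hcast : ((i : ℕ) : S) = (j : ℕ) := mul_right_cancel₀ hc hij
    rw [CharP.natCast_eq_natCast S p] at hcast
    exact Fin.ext (Nat.ModEq.eq_of_lt_of_lt hcast i.2 j.2)
  refine eq_of_natDegree_lt_card_of_eval_eq _ _ hinj (fun i => ?_) (by simpa using hdeg)
  rw [heval, eval_C]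

/-- The additive polynomial `T ^ p - c ^ (p - 1) T`. In characteristic `p` it generates the ring of
polynomials in `T` that are invariant under `T ↦ T + c`. -/
noncomputable def translationPoly (p : ℕ) (c : S) : S[X] :=
  X ^ p - C (c ^ (p - 1)) * X

theorem degree_C_mul_X_lt {p : ℕ} (hp : 1 < p) (s : S) : (C s * X).degree < (p : WithBot ℕ) :=
  (degree_C_mul_X_le s).trans_lt (by exact_mod_cast hp)

theorem monic_translationPoly {p : ℕ} (hp : 1 < p) (c : S) : (translationPoly p c).Monic :=
  monic_X_pow_sub (degree_C_mul_X_lt hp _)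

theorem natDegree_translationPoly [Nontrivial S] {p : ℕ} (hp : 1 < p) (c : S) :
    (translationPoly p c).natDegree = p := by
  refine natDegree_eq_of_degree_eq_some ?_
  rw [translationPoly, degree_sub_eq_left_of_degree_lt, degree_X_pow]
  rw [degree_X_pow]
  exact degree_C_mul_X_lt hp _

theorem taylor_translationPoly (p : ℕ) [Fact p.Prime] [CharP S p] (c : S) :
    taylor c (translationPoly p c) = translationPoly p c := by
  rw [translationPoly, map_sub, taylor_mul, taylor_X_pow, taylor_C, taylor_X, add_pow_char,
    ← C_pow, ← pow_sub_one_mul (NeZero.ne p) c, C_mul]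
  ring

theorem exists_eq_comp_translationPoly [IsDomain S] {p : ℕ} [Fact p.Prime] [CharP S p] {c : S}
    (hc : c ≠ 0) {G : S[X]} (hG : taylor c G = G) :
    ∃ H : S[X], G = H.comp (translationPoly p c) := by
  have hp := (Fact.out : p.Prime).one_lt
  have hQ := monic_translationPoly hp c
  have hnd := natDegree_translationPoly hp c
  induction hn : G.natDegree using Nat.strong_induction_on generalizing G with
  | _ n ih =>
  obtain hlt | hge := lt_or_ge n p
  · exact ⟨C (G.eval 0), by rw [C_comp, ← eq_C_eval_zero_of_taylor_eq hc hG (hn ▸ hlt)]⟩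
  · obtain ⟨hmod, hdiv⟩ := taylor_modByMonic_divByMonic hQ (taylor_translationPoly p c) hG
    obtain ⟨H₁, hH₁⟩ := ih _ (by rw [natDegree_divByMonic G hQ]; omega) hdiv rfl
    have hlt := natDegree_modByMonic_lt G hQ (fun h => by simp [h] at hnd; omega)
    obtain ⟨H₂, hH₂⟩ := ih _ (by omega) hmod rfl
    exact ⟨H₂ + X * H₁, by
      rw [add_comp, mul_comp, X_comp, ← hH₁, ← hH₂, modByMonic_add_div G]⟩

end Translation

section Relation

variable {S : Type*} [CommRing S]

theorem aeval_aeval_X_X {T : Type*} [CommRing T] [Algebra S T] (u v w : T) (r : Poly2 S) :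
    MvPolynomial.aeval ![u, v, w]
        (MvPolynomial.aeval ![(MvPolynomial.X 0 : Poly3 S), MvPolynomial.X 1] r)
      = MvPolynomial.aeval ![u, v] r := by
  rw [← AlgHom.comp_apply, MvPolynomial.comp_aeval]
  congr 2
  ext i
  fin_cases i <;> simp

theorem dvd_of_dvd_pow_mul {A : Type*} [CommRing A] [IsDomain A] {b c h : A} (hb : b ≠ 0)
    (hbc : ∀ G, b ∣ c * G → b ∣ G) {n : ℕ} (hdvd : c ∣ b ^ n * h) : c ∣ h := by
  induction n with
  | zero => simpa using hdvd
  | succ n ih =>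
    obtain ⟨G, hG⟩ := hdvd
    obtain ⟨G', rfl⟩ := hbc G ⟨b ^ n * h, by rw [← hG, pow_succ']; ring⟩
    exact ih ⟨G', mul_left_cancel₀ hb (by linear_combination hG)⟩

theorem X_pow_sub_aeval_mem_nonZeroDivisors {p : ℕ} (hp : p ≠ 0) (P : S[X]) :
    (MvPolynomial.X 1 ^ p - aeval (MvPolynomial.X 0) P : Poly3 S) ∈ nonZeroDivisors (Poly3 S) := by
  let e : Poly3 S ≃ₐ[S] (Poly2 S)[X] :=
    (MvPolynomial.renameEquiv S (Equiv.swap 0 1)).trans (MvPolynomial.finSuccEquiv S 2)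
  have he0 : e (MvPolynomial.X 0) = C (MvPolynomial.X 0) := by
    simpa [e] using MvPolynomial.finSuccEquiv_X_succ (j := (0 : Fin 2))
  have he1 : e (MvPolynomial.X 1) = X := by simp [e, MvPolynomial.finSuccEquiv_X_zero]
  have heP : e (aeval (MvPolynomial.X 0) P) = C (aeval (MvPolynomial.X 0) P) := by
    rw [← aeval_algHom_apply, he0]
    exact aeval_algHom_apply (CAlgHom (R := S) (A := Poly2 S)) _ _
  have hmonic := monic_X_pow_sub_C (aeval (MvPolynomial.X 0) P : Poly2 S) hp
  rw [← heP, ← he1, ← map_pow, ← map_sub] at hmonic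
  exact mem_nonZeroDivisors_of_injective e.injective hmonic.mem_nonZeroDivisors

open Pointwise in
theorem exists_Lambda_dvd_C_pow_mul_sub (p : ℕ) (b : S) (ρ : S[X]) (lam nu : Poly2 S)
    (h : Poly3 S) :
    ∃ (N : ℕ) (r : Poly2 S), Lambda p b ρ lam nu ∣ MvPolynomial.C b ^ N * h
      - MvPolynomial.aeval ![MvPolynomial.X 0, MvPolynomial.X 1] r := by
  let ι : Poly2 S →ₐ[S] Poly3 S := MvPolynomial.aeval ![MvPolynomial.X 0, MvPolynomial.X 1]
  let mk := Ideal.Quotient.mkₐ S (Ideal.span {Lambda p b ρ lam nu})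
  have hX2 : mk (b ^ p • MvPolynomial.X 2) = mk (ι (MvPolynomial.X 1 ^ p
      - aeval (MvPolynomial.X 0) (coeffPow p ρ) - MvPolynomial.C (b ^ (p - 1)) * (lam * nu))) := by
    refine (Ideal.Quotient.mk_eq_mk_iff_sub_mem _ _).2 (Ideal.mem_span_singleton'.2 ⟨1, ?_⟩)
    simp only [ι, map_sub, map_mul, map_pow, ← aeval_algHom_apply, MvPolynomial.aeval_X,
      MvPolynomial.aeval_C, MvPolynomial.smul_eq_C_mul, Lambda, MvPolynomial.algebraMap_eq,
      Matrix.cons_val_zero, Matrix.cons_val_one, Matrix.cons_val_fin_one]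
    ring
  have hs : (b ^ p) • Set.range (MvPolynomial.X : Fin 3 → Poly3 S)
      ⊆ ((mk.comp ι).range.comap mk : Subalgebra S (Poly3 S)) := by
    rintro _ ⟨_, ⟨i, rfl⟩, rfl⟩
    fin_cases i
    · exact ⟨b ^ p • MvPolynomial.X 0, by simp [ι]⟩
    · exact ⟨b ^ p • MvPolynomial.X 1, by simp [ι]⟩
    · exact ⟨_, hX2.symm⟩
  obtain ⟨N, hN⟩ := Algebra.pow_smul_mem_of_smul_subset_of_mem_adjoin (b ^ p) _ _ hs
    (x := h) (by simp [MvPolynomial.adjoin_range_X]) (Subalgebra.algebraMap_mem _ _)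
  obtain ⟨r, hr⟩ := hN N le_rfl
  refine ⟨p * N, r, ?_⟩
  rw [← Ideal.mem_span_singleton, ← Ideal.Quotient.mk_eq_mk_iff_sub_mem, pow_mul,
    ← MvPolynomial.C_pow, ← MvPolynomial.C_pow, ← MvPolynomial.smul_eq_C_mul]
  exact hr.symm

theorem map_mk_eq_zero_iff {σ : Type*} (b : S) (g : MvPolynomial σ S) :
    MvPolynomial.map (Ideal.Quotient.mk (Ideal.span {b})) g = 0 ↔ MvPolynomial.C b ∣ g :=
  (MvPolynomial.C_dvd_iff_map_hom_eq_zero _ b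
    (fun s => by rw [Ideal.Quotient.eq_zero_iff_mem, Ideal.mem_span_singleton]) g).symm

theorem map_aeval {σ T : Type*} [CommRing T] (g : S →+* T) (s : MvPolynomial σ S) (P : S[X]) :
    MvPolynomial.map g (aeval s P) = aeval (MvPolynomial.map g s) (P.map g) :=
  map_aeval_eq_aeval_map (MvPolynomial.map_comp_C g).symm P s

theorem C_dvd_of_C_dvd_Lambda_mul {p : ℕ} (hp : 1 < p) (b : S) (ρ : S[X]) (lam nu : Poly2 S)
    {G : Poly3 S} (hG : MvPolynomial.C b ∣ Lambda p b ρ lam nu * G) : MvPolynomial.C b ∣ G := by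
  rw [← map_mk_eq_zero_iff] at hG ⊢
  set g := Ideal.Quotient.mk (Ideal.span {b})
  have hb : g b = 0 := Ideal.Quotient.mk_singleton_self b
  have hΛ : MvPolynomial.map g (Lambda p b ρ lam nu)
      = -(MvPolynomial.X 1 ^ p - aeval (MvPolynomial.X 0) ((coeffPow p ρ).map g)) := by
    simp only [Lambda, map_add, map_sub, map_mul, map_pow, MvPolynomial.map_C, hb, map_aeval,
      MvPolynomial.map_X, map_zero, zero_pow (Nat.ne_zero_of_lt hp),
      zero_pow (Nat.sub_ne_zero_of_lt hp), zero_mul]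
    ring
  rw [map_mul, hΛ] at hG
  exact (X_pow_sub_aeval_mem_nonZeroDivisors (Nat.ne_zero_of_lt hp) _).1 _
    (by linear_combination -hG)

theorem Lambda_dvd_of_aeval_eq_zero [IsDomain S] {T : Type*} [CommRing T] [Algebra S T] {p : ℕ}
    (hp : 1 < p) {b : S} (hb : b ≠ 0) {ρ : S[X]} {lam nu : Poly2 S} {u v w : T}
    (huv : Function.Injective (MvPolynomial.aeval ![u, v] : Poly2 S →ₐ[S] T))
    (hΛ : MvPolynomial.aeval ![u, v, w] (Lambda p b ρ lam nu) = 0) {h : Poly3 S}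
    (hh : MvPolynomial.aeval ![u, v, w] h = 0) : Lambda p b ρ lam nu ∣ h := by
  obtain ⟨N, r, hdvd⟩ := exists_Lambda_dvd_C_pow_mul_sub p b ρ lam nu h
  have hr : r = 0 := by
    refine huv ?_
    obtain ⟨G, hG⟩ := hdvd
    have heval := congrArg (MvPolynomial.aeval ![u, v, w]) hG
    rw [map_sub, map_mul, map_mul, hh, hΛ, mul_zero, zero_mul, zero_sub, neg_eq_zero,
      aeval_aeval_X_X] at heval
    rw [map_zero, heval]
  rw [hr, map_zero, sub_zero] at hdvd
  exact dvd_of_dvd_pow_mul (by simpa using hb)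
    (fun _ => C_dvd_of_C_dvd_Lambda_mul hp b ρ lam nu) hdvd

end Relation

section InseparableRelation

variable {S : Type*} [CommRing S] (p : ℕ) [CharP S p]

theorem derivative_eval₂_expand (ρ : S[X]) (K : S[X][X]) :
    derivative (eval₂ (expand S p : S[X] →+* S[X]) ρ K)
      = derivative ρ * eval₂ (expand S p : S[X] →+* S[X]) ρ (derivative K) := by
  induction K using Polynomial.induction_on' with
  | add P Q hP hQ => simp only [eval₂_add, map_add, hP, hQ, mul_add]
  | monomial n c =>
    have hc : derivative (expand S p c) = 0 := by
      rw [derivative_expand, CharP.cast_eq_zero, zero_mul, mul_zero]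
    rw [eval₂_monomial, derivative_monomial, eval₂_monomial, RingHom.coe_coe, derivative_mul, hc,
      derivative_pow, C_eq_natCast, map_mul, map_natCast]
    ring

variable [Fact p.Prime]

theorem coeffPow_eq_map_frobenius (ρ : S[X]) : coeffPow p ρ = ρ.map (frobenius S p) := by
  ext n
  simp only [coeffPow, finsetSum_coeff, coeff_C_mul, coeff_X_pow, coeff_map, frobenius_def,
    mul_ite, mul_one, mul_zero]
  rw [Finset.sum_ite_eq]
  split_ifs with hn
  · rfl
  · rw [coeff_eq_zero_of_natDegree_lt (by simpa using hn), zero_pow (NeZero.ne p)]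

theorem expand_coeffPow (ρ : S[X]) : expand S p (coeffPow p ρ) = ρ ^ p := by
  rw [coeffPow_eq_map_frobenius, ← map_expand, map_frobenius_expand]

variable [IsDomain S]

theorem natDegree_eq_zero_of_derivative_eq_zero_of_lt {K : S[X]} (hK : derivative K = 0)
    (hlt : K.natDegree < p) : K.natDegree = 0 := by
  have hexpand := expand_contract p hK (NeZero.ne p)
  rw [← hexpand, natDegree_expand] at hlt ⊢
  have hlt_one : (contract p K).natDegree < 1 :=
    lt_of_mul_lt_mul_right (by rwa [one_mul]) (Nat.zero_le p)
  rw [Nat.lt_one_iff.1 hlt_one, zero_mul]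

theorem eq_zero_of_eval₂_expand_eq_zero {ρ : S[X]} (hρ : derivative ρ ≠ 0) {K : S[X][X]}
    (hlt : K.natDegree < p) (hK : eval₂ (expand S p : S[X] →+* S[X]) ρ K = 0) : K = 0 := by
  induction hn : K.natDegree using Nat.strong_induction_on generalizing K with
  | _ n ih =>
  have hderiv : eval₂ (expand S p : S[X] →+* S[X]) ρ (derivative K) = 0 := by
    have h := derivative_eval₂_expand p ρ K
    rw [hK, derivative_zero] at h
    exact (mul_eq_zero.1 h.symm).resolve_left hρ
  have hconst : K.natDegree = 0 := by
    by_contra hne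
    have hdeg := natDegree_derivative_lt hne
    exact hne (natDegree_eq_zero_of_derivative_eq_zero_of_lt p
      (ih _ (hn ▸ hdeg) (hdeg.trans hlt) hderiv rfl) hlt)
  rw [eq_C_of_natDegree_eq_zero hconst, eval₂_C, RingHom.coe_coe,
    expand_eq_zero (NeZero.pos p)] at hK
  rw [eq_C_of_natDegree_eq_zero hconst, hK, C_0]

theorem X_pow_sub_dvd_of_eval₂_expand_eq_zero {ρ : S[X]} (hρ : derivative ρ ≠ 0) {K : S[X][X]}
    (hK : eval₂ (expand S p : S[X] →+* S[X]) ρ K = 0) : X ^ p - C (coeffPow p ρ) ∣ K := by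
  set Γ : S[X][X] := X ^ p - C (coeffPow p ρ) with hΓ
  have hmonic : Γ.Monic := monic_X_pow_sub_C _ (NeZero.ne p)
  have hdeg : Γ.natDegree = p := natDegree_X_pow_sub_C
  have hroot : eval₂ (expand S p : S[X] →+* S[X]) ρ Γ = 0 := by
    rw [hΓ, eval₂_sub, eval₂_pow, eval₂_X, eval₂_C, RingHom.coe_coe, expand_coeffPow, sub_self]
  rw [← modByMonic_eq_zero_iff_dvd hmonic]
  refine eq_zero_of_eval₂_expand_eq_zero p hρ ?_ ?_
  · refine (natDegree_modByMonic_lt K hmonic fun h => ?_).trans_eq hdeg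
    exact NeZero.ne p (by rw [← hdeg, h, natDegree_one])
  · rwa [← modByMonic_add_div K Γ, eval₂_add, eval₂_mul, hroot, zero_mul, add_zero] at hK

theorem X_pow_sub_dvd_of_aeval_X_pow_eq_zero {ρ : S[X]} (hρ : derivative ρ ≠ 0) {r : Poly2 S}
    (hr : MvPolynomial.aeval ![X ^ p, ρ] r = 0) :
    MvPolynomial.X 1 ^ p - aeval (MvPolynomial.X 0) (coeffPow p ρ) ∣ r := by
  obtain ⟨K, rfl⟩ := (Bivariate.equivMvPolynomial S).surjective r
  have heval : (MvPolynomial.aeval ![X ^ p, ρ] : Poly2 S →ₐ[S] S[X]).toRingHom.comp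
      (Bivariate.equivMvPolynomial S : S[X][X] →+* Poly2 S)
        = eval₂RingHom (expand S p : S[X] →+* S[X]) ρ := by
    ext <;> simp
  have hC (P : S[X]) : Bivariate.equivMvPolynomial S (C P) = aeval (MvPolynomial.X 0) P :=
    aevalAeval_C _ _ P
  have hdvd := map_dvd (Bivariate.equivMvPolynomial S) (X_pow_sub_dvd_of_eval₂_expand_eq_zero p hρ
    ((DFunLike.congr_fun heval K).symm.trans hr))
  rwa [map_sub, map_pow, hC, Bivariate.equivMvPolynomial_X] at hdvd

end InseparableRelation

section Transcendental

variable {S T : Type*} [CommRing S] [CommRing T] [Algebra S T]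

theorem eval₂RingHom_aeval_X_X_surjective : Function.Surjective (eval₂RingHom
    (MvPolynomial.aeval ![MvPolynomial.X 0, MvPolynomial.X 1] : Poly2 S →ₐ[S] Poly3 S).toRingHom
    (MvPolynomial.X 2)) := by
  intro h
  induction h using MvPolynomial.induction_on with
  | C c => exact ⟨C (MvPolynomial.C c), by simp⟩
  | add P Q hP hQ =>
    obtain ⟨P, rfl⟩ := hP
    obtain ⟨Q, rfl⟩ := hQ
    exact ⟨P + Q, map_add ..⟩
  | mul_X P i hP =>
    obtain ⟨P, rfl⟩ := hP
    fin_cases i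
    · exact ⟨P * C (MvPolynomial.X 0), by rw [map_mul]; simp⟩
    · exact ⟨P * C (MvPolynomial.X 1), by rw [map_mul]; simp⟩
    · exact ⟨P * X, by rw [map_mul]; simp⟩

theorem aeval_X_X_dvd_of_aeval_eq_zero {u v w : T}
    (hw : Transcendental (MvPolynomial.aeval ![u, v] : Poly2 S →ₐ[S] T).range w) {Γ : Poly2 S}
    (hΓ : ∀ r : Poly2 S, MvPolynomial.aeval ![u, v] r = 0 → Γ ∣ r) {h : Poly3 S}
    (hh : MvPolynomial.aeval ![u, v, w] h = 0) :
    MvPolynomial.aeval ![MvPolynomial.X 0, MvPolynomial.X 1] Γ ∣ h := by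
  set ev : Poly2 S →ₐ[S] T := MvPolynomial.aeval ![u, v] with hev
  obtain ⟨H, rfl⟩ := eval₂RingHom_aeval_X_X_surjective h
  have hH : H.map ev.rangeRestrict.toRingHom = 0 := by
    refine transcendental_iff.1 hw _ ?_
    rw [aeval_def, eval₂_map, ← hh, ← AlgHom.coe_toRingHom (MvPolynomial.aeval ![u, v, w]),
      coe_eval₂RingHom, hom_eval₂]
    congr 1
    · ext i
      · simp
      · fin_cases i <;> simp [hev]
    · simp
  have hdvd : C Γ ∣ H := by
    refine (C_dvd_iff_dvd_coeff _ _).2 fun n => hΓ _ ?_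
    have hn := congrArg (fun P : ev.range[X] => (P.coeff n : T)) hH
    simpa only [coeff_map] using! hn
  simpa only [coe_eval₂RingHom, eval₂_C] using!
    _root_.map_dvd (eval₂RingHom _ (MvPolynomial.X 2)) hdvd

end Transcendental

section Reduction

theorem aeval_mem {R T : Type*} [CommRing R] [CommRing T] [Algebra R T] {A : Subalgebra R T}
    {s : T} (hs : s ∈ A) (P : R[X]) : aeval s P ∈ A :=
  Algebra.adjoin_le (Set.singleton_subset_iff.2 hs) (aeval_mem_adjoin_singleton R s)

theorem mvAeval_pair_mem {R T : Type*} [CommRing R] [CommRing T] [Algebra R T]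
    {A : Subalgebra R T} {u v : T} (hu : u ∈ A) (hv : v ∈ A) (r : Poly2 R) :
    MvPolynomial.aeval ![u, v] r ∈ A := by
  have hle : Algebra.adjoin R {u, v} ≤ A := Algebra.adjoin_le (Set.pair_subset hu hv)
  rw [adjoin_pair_eq_range] at hle
  exact hle ⟨r, rfl⟩

theorem aeval_mvAeval_pair {R T : Type*} [CommRing R] [CommRing T] [Algebra R T] (s : T)
    (P Q : R[X]) (r : Poly2 R) :
    aeval s (MvPolynomial.aeval ![P, Q] r) = MvPolynomial.aeval ![aeval s P, aeval s Q] r := by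
  rw [← AlgHom.comp_apply, MvPolynomial.comp_aeval]
  congr 2
  ext i
  fin_cases i <;> rfl

theorem transcendental_add_pow_add_mul_add {A B : Type*} [CommRing A] [Nontrivial A] [CommRing B]
    [Algebra A B] {r : B} (hr : Transcendental A r) {n : ℕ} (hn : 1 < n) (s α β : A) :
    Transcendental A ((r + algebraMap A B s) ^ n
      + (algebraMap A B α * (r + algebraMap A B s) + algebraMap A B β)) := by
  have hlin : Transcendental A (r + algebraMap A B s) := by
    have h := hr.aeval (X + C s) (by simp) (by simp)
    rwa [map_add, aeval_X, aeval_C] at h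
  have hdeg : (C α * X + C β : A[X]).degree < (n : WithBot ℕ) :=
    degree_linear_le.trans_lt (by exact_mod_cast hn)
  have h := hlin.aeval (X ^ n + (C α * X + C β))
    (by rw [natDegree_add_eq_left_of_degree_lt (by rwa [degree_X_pow]), natDegree_X_pow]; omega)
    (by simp [(monic_X_pow_add hdeg).leadingCoeff])
  simpa only [map_add, map_mul, map_pow, aeval_X, aeval_C] using h

variable {S : Type*} [CommRing S]

theorem transcendental_x : Transcendental (Algebra.adjoin S {y S}) (x S) := by
  have h := MvPolynomial.transcendental_supported_X S (i := (0 : Fin 2)) (s := {1}) (by simp)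
  rwa [MvPolynomial.supported, Set.image_singleton] at h

variable [IsDomain S]

theorem X_pow_sub_dvd_of_aeval_y_pow_eq_zero (p : ℕ) [CharP S p] [Fact p.Prime] {ρ : S[X]}
    (hρ : derivative ρ ≠ 0) {w α β : Poly2 S} (hw : w ∈ Algebra.adjoin S {y S})
    (hα : α ∈ Algebra.adjoin S {y S}) (hβ : β ∈ Algebra.adjoin S {y S}) {h : Poly3 S}
    (hh : MvPolynomial.aeval
      ![y S ^ p, aeval (y S) ρ, (x S + w) ^ p + (α * (x S + w) + β)] h = 0) :
    MvPolynomial.X 1 ^ p - aeval (MvPolynomial.X 0) (coeffPow p ρ) ∣ h := by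
  have hy : y S ∈ Algebra.adjoin S {y S} := Algebra.self_mem_adjoin_singleton S _
  have hle : (MvPolynomial.aeval ![y S ^ p, aeval (y S) ρ] : Poly2 S →ₐ[S] Poly2 S).range
      ≤ Algebra.adjoin S {y S} := by
    rintro _ ⟨r, rfl⟩
    exact mvAeval_pair_mem (pow_mem hy p) (aeval_mem hy ρ) r
  have htrans : Transcendental
      (MvPolynomial.aeval ![y S ^ p, aeval (y S) ρ] : Poly2 S →ₐ[S] Poly2 S).range
      ((x S + w) ^ p + (α * (x S + w) + β)) :=
    (transcendental_add_pow_add_mul_add transcendental_x (Fact.out : p.Prime).one_lt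
      ⟨w, hw⟩ ⟨α, hα⟩ ⟨β, hβ⟩).of_tower_top_of_subalgebra_le hle
  have hker (r : Poly2 S) (hr : MvPolynomial.aeval ![y S ^ p, aeval (y S) ρ] r = 0) :
      MvPolynomial.X 1 ^ p - aeval (MvPolynomial.X 0) (coeffPow p ρ) ∣ r := by
    refine X_pow_sub_dvd_of_aeval_X_pow_eq_zero p hρ ?_
    refine transcendental_iff.1 (MvPolynomial.transcendental_X S 1 : Transcendental S (y S)) _ ?_
    rwa [aeval_mvAeval_pair, aeval_X_pow]
  have hdvd := aeval_X_X_dvd_of_aeval_eq_zero htrans hker hh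
  rwa [map_sub, map_pow, ← aeval_algHom_apply, MvPolynomial.aeval_X, MvPolynomial.aeval_X] at hdvd

end Reduction

section AlgebraicIndependence

variable {S : Type*} [CommRing S] [IsDomain S] {u v g : Poly2 S}

theorem mvAeval_injective_of_isAlgebraic_adjoin_y {c : S} (hc : c ≠ 0)
    (hy : IsAlgebraic (Algebra.adjoin S {u, v}) (y S)) (hg : g ∈ Algebra.adjoin S {y S})
    (hx : MvPolynomial.C c * x S + g ∈ Algebra.adjoin S {u, v}) :
    Function.Injective (MvPolynomial.aeval ![u, v] : Poly2 S →ₐ[S] Poly2 S) := by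
  set A := Algebra.adjoin S {u, v}
  let B : Subalgebra S (Poly2 S) := (Subalgebra.algebraicClosure A (Poly2 S)).restrictScalars S
  have hgB : g ∈ B := Algebra.adjoin_le (S := B) (Set.singleton_subset_iff.2 hy) hg
  have hcx : MvPolynomial.C c * x S ∈ B := by
    have hcxg : MvPolynomial.C c * x S + g ∈ B :=
      isAlgebraic_algebraMap (⟨_, hx⟩ : A)
    simpa using sub_mem hcxg hgB
  have hxB : x S ∈ B :=
    IsAlgebraic.of_mul (mem_nonZeroDivisors_of_ne_zero (MvPolynomial.C_ne_zero.2 hc))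
      (isAlgebraic_algebraMap (algebraMap S A c)) hcx
  have htop : B = ⊤ := by
    rw [eq_top_iff, ← MvPolynomial.adjoin_range_X]
    refine Algebra.adjoin_le (Set.range_subset_iff.2 fun i => ?_)
    fin_cases i
    exacts [hxB, hy]
  have halg : Algebra.IsAlgebraic (Algebra.adjoin S (Set.range ![u, v])) (Poly2 S) := by
    rw [Matrix.range_cons_cons_empty]
    exact ⟨fun t => (htop ▸ Algebra.mem_top : t ∈ B)⟩
  exact (Algebra.IsAlgebraic.isTranscendenceBasis_of_lift_le_trdeg_of_finite S ![u, v]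
    (by simp)).1

theorem mvAeval_y_pow_injective {p : ℕ} (hp : 0 < p) {b : S} (hb : b ≠ 0) (ρ : S[X])
    {w : Poly2 S} (hw : w ∈ Algebra.adjoin S {y S}) :
    Function.Injective (MvPolynomial.aeval ![y S ^ p,
      aeval (y S) ρ + MvPolynomial.C b * (x S + w)] : Poly2 S →ₐ[S] Poly2 S) := by
  set v := aeval (y S) ρ + MvPolynomial.C b * (x S + w) with hv
  have hyp : y S ^ p ∈ Algebra.adjoin S {y S ^ p, v} := Algebra.subset_adjoin (by simp)
  refine mvAeval_injective_of_isAlgebraic_adjoin_y hb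
    (g := aeval (y S) ρ + MvPolynomial.C b * w) ?_ ?_ ?_
  · exact IsAlgebraic.of_pow hp (isAlgebraic_algebraMap (⟨_, hyp⟩ : Algebra.adjoin S _))
  · exact add_mem (aeval_mem (Algebra.self_mem_adjoin_singleton S _) ρ)
      (mul_mem (Subalgebra.algebraMap_mem _ b) hw)
  · have hsum : MvPolynomial.C b * x S + (aeval (y S) ρ + MvPolynomial.C b * w) = v := by
      rw [hv]; ring
    rw [hsum]
    exact Algebra.subset_adjoin (by simp)

theorem mvAeval_f_y_injective {a : S} (ha : a ≠ 0) (θ : S[X]) :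
    Function.Injective (MvPolynomial.aeval ![f a θ, y S] : Poly2 S →ₐ[S] Poly2 S) := by
  have hy : y S ∈ Algebra.adjoin S {f a θ, y S} := Algebra.subset_adjoin (by simp)
  exact mvAeval_injective_of_isAlgebraic_adjoin_y ha
    (isAlgebraic_algebraMap (⟨_, hy⟩ : Algebra.adjoin S _))
    (aeval_mem (Algebra.self_mem_adjoin_singleton S _) θ) (Algebra.subset_adjoin (by simp [f]))

theorem isAlgebraic_y_of_q_mem {p : ℕ} (hp : 1 < p) {a : S} {F : Poly2 S}
    {A : Subalgebra S (Poly2 S)} (hq : q p a F ∈ A) (hF : F ∈ A) : IsAlgebraic A (y S) := by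
  have hcoeff : (MvPolynomial.C a * F) ^ (p - 1) ∈ A :=
    pow_mem (mul_mem (A.algebraMap_mem a) hF) _
  refine IsIntegral.isAlgebraic
    ⟨X ^ p - (C (⟨_, hcoeff⟩ : A) * X + C ⟨_, hq⟩), monic_X_pow_sub ?_, ?_⟩
  · exact degree_linear_le.trans_lt (by exact_mod_cast hp)
  · simp [q]

theorem mvAeval_q_injective {p : ℕ} (hp : 1 < p) {a : S} (ha : a ≠ 0) {θ : S[X]} {F : Poly2 S}
    (hF : F ∈ Algebra.adjoin S {f a θ}) (hf : f a θ ∈ Algebra.adjoin S {q p a F, v}) :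
    Function.Injective (MvPolynomial.aeval ![q p a F, v] : Poly2 S →ₐ[S] Poly2 S) := by
  have hFA : F ∈ Algebra.adjoin S {q p a F, v} :=
    Algebra.adjoin_le (Set.singleton_subset_iff.2 hf) hF
  exact mvAeval_injective_of_isAlgebraic_adjoin_y ha
    (isAlgebraic_y_of_q_mem (a := a) hp (Algebra.subset_adjoin (by simp)) hFA)
    (aeval_mem (Algebra.self_mem_adjoin_singleton S _) θ) hf

end AlgebraicIndependence

section Invariants

theorem mem_adjoin_aeval_translationPoly {S T : Type*} [CommRing S] [IsDomain S] [CommRing T]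
    [Algebra S T] (p : ℕ) [Fact p.Prime] [CharP S p] {t : T} (ht : Transcendental S t) {c : S}
    (hc : c ≠ 0) (φ : T →ₐ[S] T) (hφ : φ t = t + algebraMap S T c) {g : T}
    (hg : g ∈ Algebra.adjoin S {t}) (hinv : φ g = g) :
    g ∈ Algebra.adjoin S {aeval t (translationPoly p c)} := by
  rw [Algebra.adjoin_singleton_eq_range_aeval] at hg ⊢
  obtain ⟨G, rfl⟩ := hg
  have htaylor : taylor c G = G := by
    refine transcendental_iff_injective.1 ht ?_
    rw [taylor_apply, aeval_comp, map_add, aeval_X, aeval_C, ← hφ, aeval_algHom_apply]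
    exact hinv
  obtain ⟨H, rfl⟩ := exists_eq_comp_translationPoly hc htaylor
  exact ⟨H, (aeval_comp _).symm⟩

variable {R : Type*} [CommRing R]

open Pointwise in
theorem exists_C_pow_mul_mem_adjoin_f_y (a : R) (θ : R[X]) (g : Poly2 R) :
    ∃ N : ℕ, MvPolynomial.C (a ^ N) * g ∈ Algebra.adjoin R {f a θ, y R} := by
  have hf : f a θ ∈ Algebra.adjoin R {f a θ, y R} := Algebra.subset_adjoin (by simp)
  have hy : y R ∈ Algebra.adjoin R {f a θ, y R} := Algebra.subset_adjoin (by simp)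
  have hs : a • Set.range (MvPolynomial.X : Fin 2 → Poly2 R) ⊆ Algebra.adjoin R {f a θ, y R} := by
    rintro _ ⟨_, ⟨i, rfl⟩, rfl⟩
    fin_cases i
    · have hax : f a θ - aeval (y R) θ = a • x R := by
        rw [f, add_sub_cancel_right, MvPolynomial.smul_eq_C_mul]
      exact Set.mem_of_eq_of_mem hax.symm (sub_mem hf (aeval_mem hy θ))
    · exact Subalgebra.smul_mem _ hy a
  obtain ⟨N, hN⟩ := Algebra.pow_smul_mem_of_smul_subset_of_mem_adjoin a _ _ hs
    (x := g) (by simp [MvPolynomial.adjoin_range_X]) (Subalgebra.algebraMap_mem _ _)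
  exact ⟨N, by simpa only [MvPolynomial.smul_eq_C_mul] using hN N le_rfl⟩

variable [IsDomain R]

theorem transcendental_adjoin_f_y {a : R} (ha : a ≠ 0) (θ : R[X]) :
    Transcendental (Algebra.adjoin R {f a θ}) (y R) := by
  have hind : AlgebraicIndependent R ![f a θ, y R] := mvAeval_f_y_injective ha θ
  have h := hind.transcendental_adjoin (s := {0}) (i := 1) (by simp)
  rwa [Set.image_singleton] at h

theorem exists_C_pow_mul_mem_of_hom_eq {p : ℕ} [Fact p.Prime] [CharP R p] {a : R} (ha : a ≠ 0)
    {θ : R[X]} {F : Poly2 R} (hF : F ≠ 0) (hFf : F ∈ Algebra.adjoin R {f a θ}) {g : Poly2 R}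
    (hg : hom a θ F g = g) :
    ∃ N : ℕ, MvPolynomial.C (a ^ N) * g ∈ Algebra.adjoin R {f a θ, q p a F} := by
  obtain ⟨N, hN⟩ := exists_C_pow_mul_mem_adjoin_f_y a θ g
  refine ⟨N, ?_⟩
  set S := Algebra.adjoin R {f a θ}
  have : CharP S p := S.val.toRingHom.charP Subtype.val_injective p
  let φ : Poly2 R →ₐ[S] Poly2 R :=
    { hom a θ F with commutes' := fun s => hom_of_mem a θ F s.2 }
  let c : S := ⟨MvPolynomial.C a * F, mul_mem (S.algebraMap_mem a) hFf⟩
  have hc : c ≠ 0 := fun h =>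
    mul_ne_zero (MvPolynomial.C_ne_zero.2 ha) hF (congrArg Subtype.val h)
  have hq : aeval (y R) (translationPoly p c) = q p a F := by
    simp [translationPoly, q, c]
  have hinv : φ (MvPolynomial.C (a ^ N) * g) = MvPolynomial.C (a ^ N) * g :=
    (map_mul (hom a θ F) _ _).trans (congrArg₂ _ ((hom a θ F).commutes _) hg)
  rw [← Set.singleton_union, Algebra.adjoin_union_eq_adjoin_adjoin] at hN ⊢
  rw [← hq]
  exact mem_adjoin_aeval_translationPoly p (transcendental_adjoin_f_y ha θ) hc φ
    (hom_y a θ F) hN hinv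

end Invariants

section Generators

variable {R : Type*} [CommRing R] {p : ℕ} {a b d : R} {θ ρ : R[X]} {F z : Poly2 R}
  {A : Subalgebra R (Poly2 R)}

theorem q_mem (hy : y R ∈ A) (hF : F ∈ A) : q p a F ∈ A :=
  sub_mem (pow_mem hy p) (mul_mem (pow_mem (mul_mem (A.algebraMap_mem a) hF) _) hy)

theorem q_mul_eq (p : ℕ) (b d : R) (F : Poly2 R) :
    q p (b * d) F
      = y R ^ p - MvPolynomial.C b ^ (p - 1) * ((MvPolynomial.C d * F) ^ (p - 1) * y R) := by
  rw [q, MvPolynomial.C_mul]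
  ring

theorem f_eq_of_eq_expand_add (a : R) (hθ : θ = expand R p (thetaStar p θ) + C d * ρ) :
    f a θ = MvPolynomial.C a * x R + aeval (y R ^ p) (thetaStar p θ)
      + MvPolynomial.C d * aeval (y R) ρ := by
  rw [f]
  nth_rw 1 [hθ]
  rw [map_add, expand_aeval, map_mul, aeval_C, MvPolynomial.algebraMap_eq, add_assoc]

theorem exists_C_mul_eq_f_sub (hp : 1 < p) (hy : y R ∈ A) (hF : F ∈ A)
    (hθ : θ = expand R p (thetaStar p θ) + C d * ρ) :
    ∃ w ∈ A, MvPolynomial.C d * (aeval (y R) ρ + MvPolynomial.C b * (x R + w))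
      = f (b * d) θ - aeval (q p (b * d) F) (thetaStar p θ) := by
  obtain ⟨n, rfl⟩ : ∃ n, p = n + 2 := Nat.exists_eq_add_of_le' hp
  set u : Poly2 R := MvPolynomial.C (b * d) ^ n * F ^ (n + 1) * y R with hu
  have huA : u ∈ A :=
    mul_mem (mul_mem (pow_mem (A.algebraMap_mem _) _) (pow_mem hF _)) hy
  have hbu : MvPolynomial.C (b * d) * u ∈ A := mul_mem (A.algebraMap_mem _) huA
  have hq : q (n + 2) (b * d) F + MvPolynomial.C (b * d) * u = y R ^ (n + 2) := by
    rw [q, hu, show n + 2 - 1 = n + 1 from rfl]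
    ring
  obtain ⟨k, hk, htaylor⟩ := exists_mem_aeval_add_eq A (thetaStar (n + 2) θ)
    (q_mem (p := n + 2) (a := b * d) hy hF) hbu
  rw [hq] at htaylor
  refine ⟨(aeval (q (n + 2) (b * d) F) (derivative (thetaStar (n + 2) θ))
    + k * (MvPolynomial.C (b * d) * u)) * u,
    mul_mem (add_mem (aeval_mem (q_mem hy hF) _) (mul_mem hk hbu)) huA, ?_⟩
  rw [f_eq_of_eq_expand_add (b * d) hθ, htaylor, MvPolynomial.C_mul]
  ring

theorem expand_derivative_coeffPow (p : ℕ) [Fact p.Prime] [CharP R p] (ρ : R[X]) :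
    expand R p (derivative (coeffPow p ρ)) = derivative ρ ^ p := by
  rw [coeffPow_eq_map_frobenius, derivative_map, ← map_expand, map_frobenius_expand]

theorem exists_C_pow_mul_eq_pow_sub [Fact p.Prime] [CharP R p] (b d : R) (ρ : R[X])
    (z : Poly2 R) (hy : y R ∈ A) (hF : F ∈ A) :
    ∃ k ∈ A, MvPolynomial.C (b ^ (p - 1)) * (MvPolynomial.C b * z ^ p
        + aeval (y R) (derivative ρ) ^ p * ((MvPolynomial.C d * F) ^ (p - 1) * y R)
        + MvPolynomial.C b * k)
      = (aeval (y R) ρ + MvPolynomial.C b * z) ^ p - aeval (q p (b * d) F) (coeffPow p ρ) := by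
  set c : Poly2 R := MvPolynomial.C b with hc
  have hcA : c ∈ A := A.algebraMap_mem b
  set v : Poly2 R := (MvPolynomial.C d * F) ^ (p - 1) * y R
  have hvA : v ∈ A := mul_mem (pow_mem (mul_mem (A.algebraMap_mem d) hF) _) hy
  obtain ⟨k, hk, htaylor⟩ := exists_mem_aeval_add_eq A (coeffPow p ρ) (pow_mem hy p)
    (neg_mem (mul_mem (pow_mem hcA (p - 1)) hvA))
  rw [← sub_eq_add_neg, ← q_mul_eq, ← expand_aeval, ← expand_aeval, expand_coeffPow,
    expand_derivative_coeffPow, map_pow, map_pow] at htaylor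
  refine ⟨-(k * c ^ (p - 2) * v ^ 2),
    neg_mem (mul_mem (mul_mem hk (pow_mem hcA _)) (pow_mem hvA 2)), ?_⟩
  have hp : p - 1 = p - 2 + 1 := by have := (Fact.out : p.Prime).two_le; omega
  have hpow : c ^ (p - 1) = c * c ^ (p - 2) := by rw [hp, pow_succ']
  have hpow' : c ^ p = c ^ (p - 1) * c := (pow_sub_one_mul (NeZero.ne p) c).symm
  rw [htaylor, add_pow_char, mul_pow c z, MvPolynomial.C_pow, ← hc]
  linear_combination k * v ^ 2 * c ^ (p - 1) * hpow - z ^ p * hpow'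

theorem aeval_y_derivative_pow_mul_y {lam : Poly2 R}
    (hlam : derivative ρ ^ p * X = MvPolynomial.aeval ![X ^ p, ρ] lam) :
    aeval (y R) (derivative ρ) ^ p * y R = MvPolynomial.aeval ![y R ^ p, aeval (y R) ρ] lam := by
  have h := congrArg (aeval (y R)) hlam
  rwa [map_mul, map_pow, aeval_X, aeval_mvAeval_pair, aeval_X_pow] at h

theorem exists_C_mul_eq_sub_aeval_mul (hp : 1 < p) (b d : R) (z : Poly2 R) (hy : y R ∈ A)
    (hF : F ∈ A) {k : Poly2 R} (hk : k ∈ A) {lam : Poly2 R}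
    (hlam : derivative ρ ^ p * X = MvPolynomial.aeval ![X ^ p, ρ] lam) :
    ∃ α ∈ A, ∃ β ∈ A, ∃ m : Poly2 R,
      MvPolynomial.C b * (z ^ p + (α * z + β) + MvPolynomial.C b * m)
        = MvPolynomial.C b * z ^ p
          + aeval (y R) (derivative ρ) ^ p * ((MvPolynomial.C d * F) ^ (p - 1) * y R)
          + MvPolynomial.C b * k
          - MvPolynomial.aeval ![q p (b * d) F, aeval (y R) ρ + MvPolynomial.C b * z] lam
            * (MvPolynomial.C d * F) ^ (p - 1) := by
  set c : Poly2 R := MvPolynomial.C b with hc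
  set G : Poly2 R := (MvPolynomial.C d * F) ^ (p - 1) with hG
  have hcA : c ∈ A := A.algebraMap_mem b
  have hGA : G ∈ A := pow_mem (mul_mem (A.algebraMap_mem d) hF) _
  have hmem := mvAeval_pair_mem (pow_mem hy p) (aeval_mem hy ρ)
  set u : Poly2 R := c ^ (p - 2) * (G * y R) with hu
  have huA : u ∈ A := mul_mem (pow_mem hcA _) (mul_mem hGA hy)
  have hpair : ![q p (b * d) F, aeval (y R) ρ + c * z]
      = fun i => ![y R ^ p, aeval (y R) ρ] i + c * ![-u, z] i := by
    have hpow : p - 1 = p - 2 + 1 := by omega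
    ext i : 1
    fin_cases i
    · simp only [Fin.zero_eta, Matrix.cons_val_zero, q_mul_eq, hu, hG, ← hc]
      nth_rw 1 [hpow]
      ring
    · rfl
  obtain ⟨m, hm⟩ := exists_mvAeval_add_mul_eq ![y R ^ p, aeval (y R) ρ] ![-u, z] c lam
  rw [← hpair, ← aeval_y_derivative_pow_mul_y hlam] at hm
  simp only [Fin.sum_univ_two, Matrix.cons_val_zero, Matrix.cons_val_one] at hm
  refine ⟨_, neg_mem (mul_mem hGA (hmem (MvPolynomial.pderiv 1 lam))),
    _, add_mem hk (mul_mem (mul_mem hGA huA) (hmem (MvPolynomial.pderiv 0 lam))), -(m * G), ?_⟩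
  rw [hm]
  ring

end Generators

section Gcd

variable {R : Type*} [CommRing R] {a b c d ϖ : R} {p : ℕ} {θ ρ : R[X]}

theorem C_dvd_C_iff {σ : Type*} :
    (MvPolynomial.C c : MvPolynomial σ R) ∣ MvPolynomial.C d ↔ c ∣ d :=
  ⟨fun h => by simpa using _root_.map_dvd MvPolynomial.constantCoeff h,
    _root_.map_dvd MvPolynomial.C⟩

theorem C_dvd_aeval_y_iff {P : R[X]} : MvPolynomial.C c ∣ aeval (y R) P ↔ C c ∣ P := by
  constructor
  · intro h
    have h' := _root_.map_dvd (MvPolynomial.aeval ![0, X] : Poly2 R →ₐ[R] R[X]) h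
    rw [← aeval_algHom_apply] at h'
    simpa [y, Polynomial.algebraMap_eq] using h'
  · intro h
    simpa [MvPolynomial.algebraMap_eq] using _root_.map_dvd (aeval (y R)) h

theorem exists_isGcd [IsDomain R] [UniqueFactorizationMonoid R] (ha : a ≠ 0) (θ : R[X]) :
    ∃ d : R, IsGcd a θ d := by
  let _ : StrongNormalizationMonoid R := UniqueFactorizationMonoid.strongNormalizationMonoid
  let _ := UniqueFactorizationMonoid.toNormalizedGCDMonoid R
  set d := gcd a (derivative θ).content with hd
  have hd0 : d ≠ 0 := fun h => ha ((gcd_eq_zero_iff _ _).1 h).1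
  have hC (c : R) : (MvPolynomial.C c : Poly2 R) ∣ MvPolynomial.C d ↔
      (MvPolynomial.C c : Poly2 R) ∣ MvPolynomial.C a
        ∧ MvPolynomial.C c ∣ aeval (y R) (derivative θ) := by
    rw [C_dvd_C_iff, C_dvd_C_iff, C_dvd_aeval_y_iff, ← dvd_content_iff_C_dvd, hd, dvd_gcd_iff]
  refine ⟨d, fun e => ⟨fun h => ?_, fun h => ?_⟩⟩
  · obtain ⟨c, -, rfl⟩ := (MvPolynomial.dvd_C_iff_exists hd0).1 h
    exact (hC c).1 h
  · obtain ⟨c, -, rfl⟩ := (MvPolynomial.dvd_C_iff_exists ha).1 h.1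
    exact (hC c).2 h

theorem IsGcd.dvd_left (hd : IsGcd a θ d) : d ∣ a :=
  C_dvd_C_iff.1 ((hd _).1 dvd_rfl).1

theorem IsGcd.C_dvd_derivative (hd : IsGcd a θ d) : C d ∣ derivative θ :=
  C_dvd_aeval_y_iff.1 ((hd _).1 dvd_rfl).2

theorem coeff_thetaStar (hp : 0 < p) (hθ₀ : θ.coeff 0 = 0) (n : ℕ) :
    (thetaStar p θ).coeff n = θ.coeff (p * n) := by
  simp only [thetaStar, finsetSum_coeff, coeff_C_mul_X_pow]
  rw [Finset.sum_ite_eq, ite_eq_left_iff]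
  intro hn
  rcases Nat.eq_zero_or_pos n with rfl | hn0
  · rw [mul_zero, hθ₀]
  · refine (coeff_eq_zero_of_natDegree_lt ?_).symm
    have : θ.natDegree < n := by simpa [Nat.one_le_iff_ne_zero, hn0.ne'] using hn
    exact this.trans_le (Nat.le_mul_of_pos_left n hp)

theorem coeff_sub_expand_thetaStar (hp : 0 < p) (hθ₀ : θ.coeff 0 = 0) (n : ℕ) :
    (θ - expand R p (thetaStar p θ)).coeff n = if p ∣ n then 0 else θ.coeff n := by
  rw [coeff_sub, coeff_expand hp]
  split_ifs with hn
  · rw [coeff_thetaStar hp hθ₀, Nat.mul_div_cancel' hn, sub_self]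
  · rw [sub_zero]

theorem exists_isRho [IsDomain R] [CharP R p] (hp : p.Prime) (hθ₀ : θ.coeff 0 = 0)
    (hd0 : d ≠ 0) (hd : C d ∣ derivative θ) : ∃ ρ, IsRho p θ d ρ := by
  obtain ⟨ρ, hρ⟩ : C d ∣ θ - expand R p (thetaStar p θ) := by
    refine (C_dvd_iff_dvd_coeff _ _).2 fun n => ?_
    rw [coeff_sub_expand_thetaStar hp.pos hθ₀]
    split_ifs with hn
    · exact dvd_zero d
    · obtain ⟨n, rfl⟩ : ∃ m, n = m + 1 :=
        Nat.exists_eq_succ_of_ne_zero (by rintro rfl; exact hn (dvd_zero p))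
      have hdvd := (C_dvd_iff_dvd_coeff _ _).1 hd n
      rw [coeff_derivative, ← Nat.cast_succ] at hdvd
      exact ((CharP.isUnit_natCast_iff hp).2 hn).dvd_mul_right.1 hdvd
  have hcoeff (n : ℕ) : (if p ∣ n then 0 else θ.coeff n) = d * ρ.coeff n := by
    rw [← coeff_sub_expand_thetaStar hp.pos hθ₀, hρ, coeff_C_mul]
  refine ⟨ρ, fun n hn => ?_, fun n hn => ?_⟩
  · rw [← hcoeff, if_neg hn]
  · simpa [hn, hd0] using hcoeff n

theorem IsRho.eq_expand_add (hp : 0 < p) (hθ₀ : θ.coeff 0 = 0) (hρ : IsRho p θ d ρ) :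
    θ = expand R p (thetaStar p θ) + C d * ρ := by
  rw [← sub_eq_iff_eq_add']
  ext n
  rw [coeff_sub_expand_thetaStar hp hθ₀, coeff_C_mul]
  split_ifs with hn
  · rw [hρ.2 n hn, mul_zero]
  · rw [hρ.1 n hn]

theorem derivative_eq_C_mul [CharP R p] (hθ : θ = expand R p (thetaStar p θ) + C d * ρ) :
    derivative θ = C d * derivative ρ := by
  rw [hθ, derivative_add, derivative_expand, CharP.cast_eq_zero, zero_mul, mul_zero, zero_add,
    derivative_C_mul]

theorem IsGcd.not_C_dvd_derivative [IsDomain R] [CharP R p] (hd : IsGcd (b * d) θ d)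
    (hd0 : d ≠ 0) (hθ : θ = expand R p (thetaStar p θ) + C d * ρ) (hϖ : ¬ IsUnit ϖ)
    (hϖb : ϖ ∣ b) : ¬ C ϖ ∣ derivative ρ := by
  intro hdvd
  have hϖd : ϖ * d ∣ 1 * d := by
    rw [one_mul, ← C_dvd_C_iff (σ := Fin 2), hd, C_dvd_C_iff, C_dvd_aeval_y_iff,
      derivative_eq_C_mul hθ, mul_comm ϖ d, C_mul]
    exact ⟨mul_comm ϖ d ▸ mul_dvd_mul_right hϖb d, mul_dvd_mul_left _ hdvd⟩
  exact hϖ (isUnit_of_dvd_one ((mul_dvd_mul_iff_right hd0).1 hϖd))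

end Gcd

section Saturation

variable {S : Type*} [CommRing S] {p : ℕ} {b : S} {ρ : S[X]} {lam nu : Poly2 S}

theorem Lambda_dvd_of_aeval_y_pow_eq_zero [IsDomain S] [Fact p.Prime] [CharP S p]
    (hρ : b = 0 → derivative ρ ≠ 0) {w α β m : Poly2 S} (hw : w ∈ Algebra.adjoin S {y S})
    (hα : α ∈ Algebra.adjoin S {y S}) (hβ : β ∈ Algebra.adjoin S {y S}) {v u : Poly2 S}
    (hv : v = aeval (y S) ρ + MvPolynomial.C b * (x S + w))
    (hu : u = (x S + w) ^ p + (α * (x S + w) + β) + MvPolynomial.C b * m)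
    (hΛ : MvPolynomial.aeval ![y S ^ p, v, u] (Lambda p b ρ lam nu) = 0) {h : Poly3 S}
    (hh : MvPolynomial.aeval ![y S ^ p, v, u] h = 0) : Lambda p b ρ lam nu ∣ h := by
  have hp : p.Prime := Fact.out
  rcases eq_or_ne b 0 with rfl | hb
  · rw [MvPolynomial.C_0, zero_mul, add_zero] at hv hu
    subst hv hu
    have hdvd := X_pow_sub_dvd_of_aeval_y_pow_eq_zero p (hρ rfl) hw hα hβ hh
    rw [← neg_dvd, neg_sub] at hdvd
    simpa [Lambda, zero_pow hp.ne_zero, zero_pow (Nat.sub_ne_zero_of_lt hp.one_lt)] using hdvd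
  · subst hv
    exact Lambda_dvd_of_aeval_eq_zero hp.one_lt hb (mvAeval_y_pow_injective hp.pos hb ρ hw) hΛ hh

theorem map_mvAeval {σ τ T : Type*} [CommRing T] (g : S →+* T) (u : σ → MvPolynomial τ S)
    (r : MvPolynomial σ S) : MvPolynomial.map g (MvPolynomial.aeval u r)
      = MvPolynomial.aeval (fun i => MvPolynomial.map g (u i)) (MvPolynomial.map g r) := by
  rw [MvPolynomial.aeval_eq_bind₁, MvPolynomial.aeval_eq_bind₁, MvPolynomial.map_bind₁]

theorem map_mvAeval_pair {τ T : Type*} [CommRing T] (g : S →+* T) (u v : MvPolynomial τ S)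
    (r : Poly2 S) : MvPolynomial.map g (MvPolynomial.aeval ![u, v] r)
      = MvPolynomial.aeval ![MvPolynomial.map g u, MvPolynomial.map g v]
          (MvPolynomial.map g r) := by
  rw [map_mvAeval]
  congr 2
  ext1 i
  fin_cases i <;> rfl

theorem map_mvAeval_triple {τ T : Type*} [CommRing T] (g : S →+* T) (u v w : MvPolynomial τ S)
    (r : Poly3 S) : MvPolynomial.map g (MvPolynomial.aeval ![u, v, w] r)
      = MvPolynomial.aeval ![MvPolynomial.map g u, MvPolynomial.map g v, MvPolynomial.map g w]
          (MvPolynomial.map g r) := by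
  rw [map_mvAeval]
  congr 2
  ext1 i
  fin_cases i <;> rfl

theorem map_coeffPow {T : Type*} [CommRing T] [Fact p.Prime] [CharP S p] [CharP T p]
    (g : S →+* T) (ρ : S[X]) : (coeffPow p ρ).map g = coeffPow p (ρ.map g) := by
  rw [coeffPow_eq_map_frobenius, coeffPow_eq_map_frobenius, Polynomial.map_map,
    Polynomial.map_map, RingHom.frobenius_comm]

theorem map_Lambda {T : Type*} [CommRing T] [Fact p.Prime] [CharP S p] [CharP T p]
    (g : S →+* T) (b : S) (ρ : S[X]) (lam nu : Poly2 S) :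
    MvPolynomial.map g (Lambda p b ρ lam nu)
      = Lambda p (g b) (ρ.map g) (MvPolynomial.map g lam) (MvPolynomial.map g nu) := by
  simp only [Lambda, map_add, map_sub, map_mul, map_pow, map_aeval, map_mvAeval_pair,
    map_coeffPow, MvPolynomial.map_X, MvPolynomial.map_C]

variable {R : Type*} [CommRing R] {a ϖ : R} {θ : R[X]} {F : Poly2 R}

theorem map_mk_mem_adjoin_y (hϖ : ϖ ∣ a) {g : Poly2 R} (hg : g ∈ Algebra.adjoin R {f a θ, y R}) :
    MvPolynomial.map (Ideal.Quotient.mk (Ideal.span {ϖ})) g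
      ∈ Algebra.adjoin (R ⧸ Ideal.span {ϖ}) {y (R ⧸ Ideal.span {ϖ})} := by
  set B := Algebra.adjoin (R ⧸ Ideal.span {ϖ}) {y (R ⧸ Ideal.span {ϖ})}
  have hyB : y _ ∈ B := Algebra.self_mem_adjoin_singleton _ _
  have ha : Ideal.Quotient.mk (Ideal.span {ϖ}) a = 0 :=
    Ideal.Quotient.eq_zero_iff_mem.2 (Ideal.mem_span_singleton.2 hϖ)
  refine Algebra.adjoin_le (S := (B.restrictScalars R).comap
    (MvPolynomial.mapAlgHom (Ideal.Quotient.mkₐ R (Ideal.span {ϖ})))) (Set.pair_subset ?_ ?_) hg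
  · change MvPolynomial.map (Ideal.Quotient.mk (Ideal.span {ϖ})) (f a θ) ∈ B
    rw [f, map_add, map_mul, MvPolynomial.map_C, ha, MvPolynomial.C_0, zero_mul, zero_add,
      map_aeval, y, MvPolynomial.map_X]
    exact aeval_mem hyB _
  · change MvPolynomial.map (Ideal.Quotient.mk (Ideal.span {ϖ})) (y R) ∈ B
    rwa [y, MvPolynomial.map_X]

theorem map_mk_q (hp : 1 < p) (hϖ : ϖ ∣ a) (F : Poly2 R) :
    MvPolynomial.map (Ideal.Quotient.mk (Ideal.span {ϖ})) (q p a F)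
      = y (R ⧸ Ideal.span {ϖ}) ^ p := by
  have ha : Ideal.Quotient.mk (Ideal.span {ϖ}) a = 0 :=
    Ideal.Quotient.eq_zero_iff_mem.2 (Ideal.mem_span_singleton.2 hϖ)
  simp [q, y, ha, zero_pow (Nat.sub_ne_zero_of_lt hp)]

variable {w α β m : Poly2 R} {b : R} {ρ : R[X]} {lam nu : Poly2 R}

theorem map_Lambda_dvd_of_C_dvd_aeval [IsDomain R] [Fact p.Prime] [CharP R p] (hϖ : Prime ϖ)
    (hϖa : ϖ ∣ a) (hρ : ϖ ∣ b → ¬ C ϖ ∣ derivative ρ)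
    (hw : w ∈ Algebra.adjoin R {f a θ, y R}) (hα : α ∈ Algebra.adjoin R {f a θ, y R})
    (hβ : β ∈ Algebra.adjoin R {f a θ, y R}) {q₁ q₂ : Poly2 R}
    (hq₁ : q₁ = aeval (y R) ρ + MvPolynomial.C b * (x R + w))
    (hq₂ : q₂ = (x R + w) ^ p + (α * (x R + w) + β) + MvPolynomial.C b * m)
    (hΛ : MvPolynomial.aeval ![q p a F, q₁, q₂] (Lambda p b ρ lam nu) = 0) {h : Poly3 R}
    (hh : MvPolynomial.C ϖ ∣ MvPolynomial.aeval ![q p a F, q₁, q₂] h) :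
    MvPolynomial.map (Ideal.Quotient.mk (Ideal.span {ϖ})) (Lambda p b ρ lam nu)
      ∣ MvPolynomial.map (Ideal.Quotient.mk (Ideal.span {ϖ})) h := by
  have : (Ideal.span {ϖ}).IsPrime := (Ideal.span_singleton_prime hϖ.ne_zero).2 hϖ
  have : CharP (R ⧸ Ideal.span {ϖ}) p :=
    CharP.of_ringHom_of_ne_zero (Ideal.Quotient.mk (Ideal.span {ϖ})) p (NeZero.ne p)
  have hp : 1 < p := (Fact.out : p.Prime).one_lt
  rw [← map_mk_eq_zero_iff, map_mvAeval_triple, map_mk_q hp hϖa] at hh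
  have hΛ' := congrArg (MvPolynomial.map (Ideal.Quotient.mk (Ideal.span {ϖ}))) hΛ
  rw [map_mvAeval_triple, map_mk_q hp hϖa, map_zero, map_Lambda] at hΛ'
  rw [map_Lambda]
  have hρ' (hb : Ideal.Quotient.mk (Ideal.span {ϖ}) b = 0) :
      derivative (ρ.map (Ideal.Quotient.mk (Ideal.span {ϖ}))) ≠ 0 := by
    rw [Ideal.Quotient.eq_zero_iff_mem, Ideal.mem_span_singleton] at hb
    rw [derivative_map]
    refine fun h0 => hρ hb ((C_dvd_iff_dvd_coeff _ _).2 fun n => ?_)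
    have hn := congrArg (coeff · n) h0
    rwa [coeff_map, coeff_zero, Ideal.Quotient.eq_zero_iff_mem, Ideal.mem_span_singleton] at hn
  refine Lambda_dvd_of_aeval_y_pow_eq_zero hρ' (map_mk_mem_adjoin_y hϖa hw)
    (map_mk_mem_adjoin_y hϖa hα) (map_mk_mem_adjoin_y hϖa hβ)
    (m := MvPolynomial.map (Ideal.Quotient.mk _) m) ?_ ?_ hΛ' hh
  · rw [hq₁]; simp [x, y, map_aeval]
  · rw [hq₂]; simp [x]

theorem mem_adjoin_of_C_mul_mem [IsDomain R] [Fact p.Prime] [CharP R p] (hϖ : Prime ϖ)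
    (hϖa : ϖ ∣ a) (hρ : ϖ ∣ b → ¬ C ϖ ∣ derivative ρ)
    (hw : w ∈ Algebra.adjoin R {f a θ, y R}) (hα : α ∈ Algebra.adjoin R {f a θ, y R})
    (hβ : β ∈ Algebra.adjoin R {f a θ, y R}) {q₁ q₂ : Poly2 R}
    (hq₁ : q₁ = aeval (y R) ρ + MvPolynomial.C b * (x R + w))
    (hq₂ : q₂ = (x R + w) ^ p + (α * (x R + w) + β) + MvPolynomial.C b * m)
    (hΛ : MvPolynomial.aeval ![q p a F, q₁, q₂] (Lambda p b ρ lam nu) = 0) {g : Poly2 R}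
    (hg : ϖ • g ∈ Algebra.adjoin R {q p a F, q₁, q₂}) :
    g ∈ Algebra.adjoin R {q p a F, q₁, q₂} := by
  rw [adjoin_triple_eq_range] at hg ⊢
  obtain ⟨h, hh⟩ := hg
  change MvPolynomial.aeval _ h = _ at hh
  rw [MvPolynomial.smul_eq_C_mul] at hh
  obtain ⟨k, hk⟩ := map_Lambda_dvd_of_C_dvd_aeval hϖ hϖa hρ hw hα hβ hq₁ hq₂ hΛ ⟨g, hh⟩
  obtain ⟨k, rfl⟩ := MvPolynomial.map_surjective _ Ideal.Quotient.mk_surjective k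
  rw [← map_mul, ← sub_eq_zero, ← map_sub, map_mk_eq_zero_iff] at hk
  obtain ⟨h', hh'⟩ := hk
  refine ⟨h', mul_left_cancel₀ (MvPolynomial.C_ne_zero.2 hϖ.ne_zero) ?_⟩
  have heval := congrArg (MvPolynomial.aeval ![q p a F, q₁, q₂]) hh'
  rw [map_sub, map_mul, map_mul, hΛ, zero_mul, sub_zero, hh, MvPolynomial.aeval_C] at heval
  exact heval.symm

theorem mem_of_smul_mem {M : Type*} [AddCommGroup M] [Module R M] [IsDomain R]
    [UniqueFactorizationMonoid R] {B : Submodule R M} {c : R} (hc : c ≠ 0)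
    (hB : ∀ ϖ : R, Prime ϖ → ϖ ∣ c → ∀ g : M, ϖ • g ∈ B → g ∈ B) {g : M} (hg : c • g ∈ B) :
    g ∈ B := by
  induction c using UniqueFactorizationMonoid.induction_on_prime generalizing g with
  | h₁ => exact absurd rfl hc
  | h₂ c hunit => exact (B.smul_mem_iff_of_isUnit hunit).1 hg
  | h₃ c ϖ hc0 hϖ ih =>
    refine ih hc0 (fun π hπ hπc => hB π hπ (hπc.mul_left ϖ)) (hB ϖ hϖ (dvd_mul_right ϖ c) _ ?_)
    rwa [smul_smul]

end Saturation

section InvariantRing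

variable {R : Type*} [CommRing R] {p : ℕ} {a b c d : R} {θ ρ : R[X]} {F g u v : Poly2 R}

theorem hom_q [Fact p.Prime] [CharP R p] (hF : F ∈ Algebra.adjoin R {f a θ}) :
    hom a θ F (q p a F) = q p a F := by
  have hC : hom a θ F (MvPolynomial.C a) = MvPolynomial.C a := (hom a θ F).commutes a
  rw [q, map_sub, map_mul, map_pow, map_pow, map_mul, hC, hom_y, hom_of_mem a θ F hF,
    add_pow_char]
  linear_combination -pow_sub_one_mul (NeZero.ne p) (MvPolynomial.C a * F)

theorem mem_equalizer_of_C_mul_eq [IsDomain R] {φ : Poly2 R →ₐ[R] Poly2 R} {e : Poly2 R}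
    (hc : c ≠ 0) (hg : MvPolynomial.C c * g = e)
    (he : e ∈ AlgHom.equalizer φ (AlgHom.id R (Poly2 R))) :
    g ∈ AlgHom.equalizer φ (AlgHom.id R (Poly2 R)) := by
  have hC : φ (MvPolynomial.C c) = MvPolynomial.C c := φ.commutes c
  rw [← hg, AlgHom.mem_equalizer, map_mul, hC] at he
  exact mul_left_cancel₀ (MvPolynomial.C_ne_zero.2 hc) he

theorem f_mem_adjoin_pair {P : R[X]} (hf : MvPolynomial.C d * v = f a θ - aeval u P) :
    f a θ ∈ Algebra.adjoin R {u, v} := by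
  rw [eq_add_of_sub_eq hf.symm]
  exact add_mem (mul_mem (Subalgebra.algebraMap_mem _ d) (Algebra.subset_adjoin (by simp)))
    (aeval_mem (Algebra.subset_adjoin (by simp)) P)

theorem exists_eq_mvAeval_of_mem_adjoin_f {P : R[X]}
    (hf : MvPolynomial.C d * v = f a θ - aeval u P) (hg : g ∈ Algebra.adjoin R {f a θ}) :
    ∃ r : Poly2 R, g = MvPolynomial.aeval ![u, v] r := by
  have hmem : g ∈ Algebra.adjoin R {u, v} :=
    Algebra.adjoin_le (Set.singleton_subset_iff.2 (f_mem_adjoin_pair hf)) hg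
  rw [adjoin_pair_eq_range] at hmem
  exact hmem.imp fun r hr => hr.symm

theorem aeval_Lambda_eq_zero (hp : p ≠ 0) {lam nu : Poly2 R} {w v' G : Poly2 R}
    (hv' : MvPolynomial.C (b ^ (p - 1)) * v' = v ^ p - aeval u (coeffPow p ρ))
    (hw : MvPolynomial.C b * w = v' - MvPolynomial.aeval ![u, v] lam * G)
    (hG : G = MvPolynomial.aeval ![u, v] nu) :
    MvPolynomial.aeval ![u, v, w] (Lambda p b ρ lam nu) = 0 := by
  rw [Lambda, ← pow_sub_one_mul hp b]
  simp only [map_add, map_sub, map_mul, map_pow _ _ p, aeval_aeval_X_X, ← hG,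
    ← aeval_algHom_apply, MvPolynomial.aeval_X, MvPolynomial.aeval_C,
    MvPolynomial.algebraMap_eq, Matrix.cons_val_zero, Matrix.cons_val_one, Matrix.cons_val]
  linear_combination MvPolynomial.C (b ^ (p - 1)) * hw + hv'

section Subalgebra

variable {T : Type*} [CommRing T] [Algebra R T] {B : Subalgebra R T} (u v w : B)

theorem coe_aeval_triple (h : Poly3 R) :
    (MvPolynomial.aeval ![u, v, w] h : T) = MvPolynomial.aeval ![(u : T), v, w] h := by
  rw [← Subalgebra.coe_val, ← AlgHom.comp_apply, MvPolynomial.comp_aeval]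
  congr 2
  ext i
  fin_cases i <;> rfl

theorem aeval_triple_surjective (hB : B = Algebra.adjoin R {(u : T), (v : T), (w : T)}) :
    Function.Surjective (MvPolynomial.aeval ![u, v, w] : Poly3 R →ₐ[R] B) := by
  intro t
  have ht : (t : T) ∈ Algebra.adjoin R {(u : T), (v : T), (w : T)} := hB ▸ t.2
  rw [adjoin_triple_eq_range] at ht
  obtain ⟨h, hh⟩ := ht
  exact ⟨h, Subtype.ext ((coe_aeval_triple u v w h).trans hh)⟩

end Subalgebra

theorem ker_aeval_eq_span_Lambda [IsDomain R] {T : Type*} [CommRing T] [Algebra R T]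
    {B : Subalgebra R T} {u v w : B} (hp : 1 < p) (hb : b ≠ 0) {lam nu : Poly2 R}
    (huv : Function.Injective (MvPolynomial.aeval ![(u : T), (v : T)] : Poly2 R →ₐ[R] T))
    (hΛ : MvPolynomial.aeval ![(u : T), (v : T), (w : T)] (Lambda p b ρ lam nu) = 0) :
    RingHom.ker (MvPolynomial.aeval ![u, v, w] : Poly3 R →ₐ[R] B)
      = Ideal.span {Lambda p b ρ lam nu} := by
  ext h
  rw [RingHom.mem_ker, Ideal.mem_span_singleton, ← ZeroMemClass.coe_eq_zero, coe_aeval_triple]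
  refine ⟨Lambda_dvd_of_aeval_eq_zero hp hb huv hΛ, ?_⟩
  rintro ⟨k, rfl⟩
  rw [map_mul, hΛ, zero_mul]

theorem nonempty_algEquiv_quotient {A B : Type*} [CommRing A] [Algebra R A] [CommRing B]
    [Algebra R B] {φ : A →ₐ[R] B} (hφ : Function.Surjective φ) {I : Ideal A}
    (hker : RingHom.ker φ = I) : Nonempty (B ≃ₐ[R] A ⧸ I) :=
  ⟨((Ideal.quotientEquivAlgOfEq R hker.symm).trans
    (Ideal.quotientKerAlgEquivOfSurjective hφ)).symm⟩

theorem invariants_eq_adjoin [IsDomain R] [UniqueFactorizationMonoid R] [Fact p.Prime]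
    [CharP R p] (ha : a ≠ 0) (hF : F ≠ 0) (hFf : F ∈ Algebra.adjoin R {f a θ})
    {q₁ q₂ : Poly2 R} (hf : f a θ ∈ Algebra.adjoin R {q p a F, q₁})
    (hq : q p a F ∈ invariants (aut a ha θ F hFf)) (hq₁ : q₁ ∈ invariants (aut a ha θ F hFf))
    (hq₂ : q₂ ∈ invariants (aut a ha θ F hFf))
    (hsat : ∀ ϖ : R, Prime ϖ → ϖ ∣ a → ∀ g : Poly2 R,
      ϖ • g ∈ Algebra.adjoin R {q p a F, q₁, q₂} → g ∈ Algebra.adjoin R {q p a F, q₁, q₂}) :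
    invariants (aut a ha θ F hFf) = Algebra.adjoin R {q p a F, q₁, q₂} := by
  refine le_antisymm (fun g hg => ?_) (Algebra.adjoin_le ?_)
  · obtain ⟨N, hN⟩ := exists_C_pow_mul_mem_of_hom_eq (p := p) ha hF hFf hg
    have hle : Algebra.adjoin R {f a θ, q p a F} ≤ Algebra.adjoin R {q p a F, q₁, q₂} :=
      Algebra.adjoin_le (Set.pair_subset (Algebra.adjoin_mono (by grind) hf)
        (Algebra.subset_adjoin (by simp)))
    refine mem_of_smul_mem (B := Subalgebra.toSubmodule (Algebra.adjoin R {q p a F, q₁, q₂}))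
      (pow_ne_zero N ha) (fun ϖ hϖ hϖa => hsat ϖ hϖ (hϖ.dvd_of_dvd_pow hϖa)) ?_
    rw [MvPolynomial.smul_eq_C_mul]
    exact hle hN
  · rintro _ (rfl | rfl | rfl)
    exacts [hq, hq₁, hq₂]

theorem generators_mem_invariants [IsDomain R] [Fact p.Prime] [CharP R p] (ha : a ≠ 0)
    (hb : b ≠ 0) (hd : d ≠ 0) (hFf : F ∈ Algebra.adjoin R {f a θ}) {P Q : R[X]} {n : ℕ}
    {q₁ q₁' q₂ G : Poly2 R} {lam : Poly2 R} (hG : G ∈ Algebra.adjoin R {f a θ})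
    (hq₁ : MvPolynomial.C d * q₁ = f a θ - aeval (q p a F) P)
    (hq₁' : MvPolynomial.C (b ^ n) * q₁' = q₁ ^ p - aeval (q p a F) Q)
    (hq₂ : MvPolynomial.C b * q₂ = q₁' - MvPolynomial.aeval ![q p a F, q₁] lam * G) :
    q p a F ∈ invariants (aut a ha θ F hFf) ∧ q₁ ∈ invariants (aut a ha θ F hFf) ∧
      q₂ ∈ invariants (aut a ha θ F hFf) := by
  have h₀ : q p a F ∈ invariants (aut a ha θ F hFf) := hom_q hFf
  have h₁ : q₁ ∈ invariants (aut a ha θ F hFf) :=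
    mem_equalizer_of_C_mul_eq hd hq₁ (sub_mem (hom_f a θ F) (aeval_mem h₀ P))
  have h₁' : q₁' ∈ invariants (aut a ha θ F hFf) :=
    mem_equalizer_of_C_mul_eq (pow_ne_zero n hb) hq₁' (sub_mem (pow_mem h₁ p) (aeval_mem h₀ Q))
  exact ⟨h₀, h₁, mem_equalizer_of_C_mul_eq hb hq₂
    (sub_mem h₁' (mul_mem (mvAeval_pair_mem h₀ h₁ lam) (hom_of_mem a θ F hG)))⟩

end InvariantRing

end Nagata

open Nagata in
theorem mainTheorem9 {R : Type*} [CommRing R] [IsDomain R] [UniqueFactorizationMonoid R]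
    (p : ℕ) [CharP R p] (hp : 0 < p)
    (a : R) (ha : a ≠ 0)
    (θ : R[X]) (hθ : θ ≠ 0) (hθ₀ : θ.coeff 0 = 0)
    (F : Nagata.Poly2 R) (hF : F ≠ 0) (hFf : F ∈ Algebra.adjoin R {Nagata.f a θ}) :
    -- a greatest common divisor `d` of `a` and `θ'(y)` exists
    (∃ d : R, Nagata.IsGcd a θ d) ∧
    -- and for each choice of `d`, with the elements `b`, `ρ`, `q₁`, `q₁'` that it determines
    ∀ d : R, Nagata.IsGcd a θ d →
    ∃ (b : R) (ρ : R[X]) (q₁ q₁' : Nagata.Poly2 R),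
      a = b * d ∧
      Nagata.IsRho p θ d ρ ∧
      MvPolynomial.C d * q₁
        = Nagata.f a θ - aeval (Nagata.q p a F) (Nagata.thetaStar p θ) ∧
      MvPolynomial.C (b ^ (p - 1)) * q₁'
        = q₁ ^ p - aeval (Nagata.q p a F) (Nagata.coeffPow p ρ) ∧
      -- suitable `λ` and `ν` exist
      (∃ lam : MvPolynomial (Fin 2) R,
        derivative ρ ^ p * X = MvPolynomial.aeval ![X ^ p, ρ] lam) ∧
      (∃ nu : MvPolynomial (Fin 2) R,
        (MvPolynomial.C d * F) ^ (p - 1) = MvPolynomial.aeval ![Nagata.q p a F, q₁] nu) ∧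
      -- and for each choice of `λ` and `ν`, with the element `q₂` that it determines
      ∀ lam nu : MvPolynomial (Fin 2) R,
        derivative ρ ^ p * X = MvPolynomial.aeval ![X ^ p, ρ] lam →
        (MvPolynomial.C d * F) ^ (p - 1) = MvPolynomial.aeval ![Nagata.q p a F, q₁] nu →
        ∃ q₂ : Nagata.Poly2 R,
          MvPolynomial.C b * q₂
            = q₁' - MvPolynomial.aeval ![Nagata.q p a F, q₁] lam
                * (MvPolynomial.C d * F) ^ (p - 1) ∧
          ∃ (h₀ : Nagata.q p a F ∈ Nagata.invariants (Nagata.aut a ha θ F hFf))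
            (h₁ : q₁ ∈ Nagata.invariants (Nagata.aut a ha θ F hFf))
            (h₂ : q₂ ∈ Nagata.invariants (Nagata.aut a ha θ F hFf)),
            Nagata.invariants (Nagata.aut a ha θ F hFf)
              = Algebra.adjoin R {Nagata.q p a F, q₁, q₂} ∧
            RingHom.ker (MvPolynomial.aeval ![⟨Nagata.q p a F, h₀⟩, ⟨q₁, h₁⟩, ⟨q₂, h₂⟩] :
                Nagata.Poly3 R →ₐ[R] Nagata.invariants (Nagata.aut a ha θ F hFf))
              = Ideal.span {Nagata.Lambda p b ρ lam nu} ∧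
            Nonempty (Nagata.invariants (Nagata.aut a ha θ F hFf) ≃ₐ[R]
              Nagata.Poly3 R ⧸ Ideal.span {Nagata.Lambda p b ρ lam nu}) := by
  have : Fact p.Prime := ⟨(CharP.char_is_prime_or_zero R p).resolve_right hp.ne'⟩
  have hp1 : 1 < p := (Fact.out : p.Prime).one_lt
  refine ⟨exists_isGcd ha θ, fun d hd => ?_⟩
  obtain ⟨b, rfl⟩ : ∃ b, a = b * d := exists_eq_mul_left_of_dvd hd.dvd_left
  obtain ⟨hb0, hd0⟩ := mul_ne_zero_iff.1 ha
  obtain ⟨ρ, hρ⟩ := exists_isRho Fact.out hθ₀ hd0 hd.C_dvd_derivative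
  have hθρ := hρ.eq_expand_add hp hθ₀
  have hy : y R ∈ Algebra.adjoin R {f (b * d) θ, y R} := Algebra.subset_adjoin (by simp)
  have hFA : F ∈ Algebra.adjoin R {f (b * d) θ, y R} := Algebra.adjoin_mono (by simp) hFf
  obtain ⟨w, hw, hq₁⟩ := exists_C_mul_eq_f_sub hp1 hy hFA hθρ
  obtain ⟨k, hk, hq₁'⟩ := exists_C_pow_mul_eq_pow_sub b d ρ (x R + w) hy hFA
  have hGf : (MvPolynomial.C d * F) ^ (p - 1) ∈ Algebra.adjoin R {f (b * d) θ} :=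
    pow_mem (mul_mem (Subalgebra.algebraMap_mem _ d) hFf) _
  refine ⟨b, ρ, _, _, rfl, hρ, hq₁, hq₁', exists_derivative_pow_mul_X_eq_aeval p ρ,
    exists_eq_mvAeval_of_mem_adjoin_f hq₁ hGf, fun lam nu hlam hnu => ?_⟩
  obtain ⟨α, hα, β, hβ, m, hq₂⟩ :=
    exists_C_mul_eq_sub_aeval_mul hp1 b d (x R + w) hy hFA hk hlam
  obtain ⟨h₀, h₁, h₂⟩ := generators_mem_invariants ha hb0 hd0 hFf hGf hq₁ hq₁' hq₂
  have hΛ := aeval_Lambda_eq_zero hp.ne' hq₁' hq₂ hnu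
  have hf := f_mem_adjoin_pair hq₁
  have hgen := invariants_eq_adjoin ha hF hFf hf h₀ h₁ h₂ fun ϖ hϖ hϖa g =>
    mem_adjoin_of_C_mul_mem hϖ hϖa (hd.not_C_dvd_derivative hd0 hθρ hϖ.not_isUnit) hw hα hβ rfl
      rfl hΛ
  have hsurj := aeval_triple_surjective (⟨_, h₀⟩ : invariants _) ⟨_, h₁⟩ ⟨_, h₂⟩ hgen
  have hker := ker_aeval_eq_span_Lambda (u := ⟨_, h₀⟩) (v := ⟨_, h₁⟩) (w := ⟨_, h₂⟩) hp1 hb0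
    (mvAeval_q_injective hp1 ha hFf hf) hΛ
  exact ⟨_, hq₂, h₀, h₁, h₂, hgen, hker, nonempty_algEquiv_quotient hsurj hker⟩
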